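/- **Theorem (Equivalence of PDE, non-smooth case).** Let $\mathbb S^2\subset\mathbb R^3$ be the unit sphere with its round metric, surface measure $dS$ and geodesic distance $d_{\mathbb S^2}$, and let $c(x,y)=\tfrac12 d_{\mathbb S^2}(x,y)^2$. Let $f_1,f_2:\mathbb S^2\to\mathbb R$ be densities such that $f_1\ge 0$, $f_1\in L^q(\mathbb S^2)$ for some $q\ge 1$, $f_2$ is integrable, $f_2\ge m$ on $\mathbb S^2$ for some constant $m>0$, and $\int_{\mathbb S^2} f_1\,dS=\int_{\mathbb S^2} f_2\,dS$. For $x\in\mathbb S^2$ and $p$ in the tangent plane $\mathcal T_x$ put $T(x,p)=\exp_x(p)$ and $$A(x,p)=D^2_{\mathbb S^2,xx}c\,(x,T(x,p)),\qquad H(x,p)=\bigl|\det D^2_{\mathbb S^2,xy}c\,(x,T(x,p))\bigr|\,\frac{f_1(x)}{f_2(T(x,p))}.$$ For a symmetric endomorphism $M$ of $\mathcal T_x$ let $$F(x,p,M)=-\det\bigl(M+A(x,p)\bigr)+H(x,p),$$ $$\mathcal E(F)=\bigl\{\phi\in C^2(\mathbb S^2): D^2\phi(x)+A(x,\nabla\phi(x))\ge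 0\ \text{for all } x\in\mathbb S^2\bigr\}.$$ Let $\det^+$ be any function with $\det^+(M)=\det M$ if $M\ge 0$ and $\det^+(M)<0$ otherwise, let $R>\pi$, and put $$F^+(x,p,M)=-{\det}^+\bigl(M+A(x,p)\bigr)+H(x,p),\qquad G(x,p,M)=\max\bigl\{F^+(x,p,M),\ \|p\|-R\bigr\},\qquad \mathcal E(G)=C^2(\mathbb S^2).$$ For $K\in\{F,G\}$, a continuous function $u:\mathbb S^2\to\mathbb R$ is a viscosity solution of $K(x,\nabla u,D^2u)=0$ if for all $x_0\in\mathbb S^2$ and $\phi\in C^\infty(\mathbb S^2)\cap\mathcal E(K)$: $K_*(x_0,\nabla\phi(x_0),D^2\phi(x_0))\le 0$ whenever $u-\phi$ has a local maximum at $x_0$, and $K^*(x_0,\nabla\phi(x_0),D^2\phi(x_0))\ge 0$ whenever $u-\phi$ has a local minimum at $x_0$. Here $K_*$ and $K^*$ are the lower and upper semicontinuous envelopes of $K$ in all variables $(x,p,M)$. (At $\|p\|=\pi$, where $c(\cdot,T(x,p))$ is not differentiable at $x$, the values of $A$ and $H$ are fixed by convention.) A function $u$ is $c$-convex if there is $\psi:\mathbb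 S^2\to\mathbb R$ with $u(x)=\sup_{y\in\mathbb S^2}\{-c(x,y)-\psi(y)\}$ for all $x\in\mathbb S^2$. If $u\in C^{0,1}(\mathbb S^2)$ is a $c$-convex viscosity solution of $F(x,\nabla u,D^2u)=0$, then $u$ is a viscosity solution of $G(x,\nabla u,D^2u)=0$. -/

import Mathlib

open scoped Manifold ContDiff Topology

noncomputable section

namespace SphereOT

/-! ### The unit sphere, its tangent planes and its exponential map -/

/-- Euclidean three-space. -/
abbrev E3 : Type := EuclideanSpace ℝ (Fin 3)

/-- The unit sphere `𝕊²` in `ℝ³`. -/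
abbrev S2 : Type := Metric.sphere (0 : E3) 1

/-- The tangent plane of the sphere at `x`, as the plane through the origin orthogonal to `x`,
with the inner product of `ℝ³` (this is the round metric). -/
abbrev TangentPlane (x : S2) : Submodule ℝ E3 := (ℝ ∙ (x : E3))ᗮ

theorem exp_mem (x : S2) (v : TangentPlane x) :
    Real.cos ‖v‖ • (x : E3) + Real.sinc ‖v‖ • (v : E3) ∈ Metric.sphere (0 : E3) 1 := by
  have hx : ‖(x : E3)‖ = 1 := by simp
  have hxv : inner ℝ (x : E3) (v : E3) = 0 := Submodule.mem_orthogonal_singleton_iff_inner_right.1 v.2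
  have hs : Real.sinc ‖v‖ * ‖v‖ = Real.sin ‖v‖ := by
    by_cases h : ‖v‖ = 0
    · simp [h]
    · rw [Real.sinc_of_ne_zero h]; field_simp
  have h2 : ‖Real.cos ‖v‖ • (x : E3) + Real.sinc ‖v‖ • (v : E3)‖ ^ 2 = 1 := by
    rw [norm_add_sq_real, norm_smul, norm_smul, inner_smul_left, inner_smul_right, hxv, hx]
    have : ‖Real.sinc ‖v‖‖ * ‖(v : E3)‖ = ‖Real.sin ‖v‖‖ := by
      rw [← hs, norm_mul]; simp
    rw [this]
    simp only [Real.norm_eq_abs, mul_one, sq_abs, mul_zero, add_zero]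
    exact Real.cos_sq_add_sin_sq _
  have h3 : ‖Real.cos ‖v‖ • (x : E3) + Real.sinc ‖v‖ • (v : E3)‖ = 1 := by
    have := norm_nonneg (Real.cos ‖v‖ • (x : E3) + Real.sinc ‖v‖ • (v : E3))
    nlinarith
  simpa using h3

/-- The exponential map of the sphere: `exp_x v = cos |v| x + (sin |v| / |v|) v`. -/
def expS (x : S2) (v : TangentPlane x) : S2 :=
  ⟨Real.cos ‖v‖ • (x : E3) + Real.sinc ‖v‖ • (v : E3), exp_mem x v⟩

/-- The function `u` written in geodesic normal coordinates centred at `x`. -/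
def inNormalCoords (u : S2 → ℝ) (x : S2) : TangentPlane x → ℝ := fun v => u (expS x v)

/-- The surface gradient of `u` at `x`, computed in geodesic normal coordinates at `x`. -/
def grad (u : S2 → ℝ) (x : S2) : TangentPlane x := gradient (inNormalCoords u x) 0

/-- The surface Hessian of `u` at `x` as an endomorphism of the tangent plane, computed in
geodesic normal coordinates at `x` (where the Christoffel symbols vanish at the centre). -/
def hess (u : S2 → ℝ) (x : S2) : TangentPlane x →L[ℝ] TangentPlane x :=
  fderiv ℝ (gradient (inNormalCoords u x)) 0

/-! ### The squared geodesic cost and the coefficients of the equation -/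

/-- The geodesic distance on the unit sphere. -/
def geoDist (x y : S2) : ℝ := 2 * Real.arcsin (‖(x : E3) - (y : E3)‖ / 2)

/-- The squared geodesic cost. -/
def cost (x y : S2) : ℝ := geoDist x y ^ 2 / 2

/-- The map `T(x,p)` of the squared geodesic cost. -/
def transport (x : S2) (p : TangentPlane x) : S2 := expS x p

/-- `A(x,p) = D²_{xx} c(x, T(x,p))`. -/
def coeffA (x : S2) (p : TangentPlane x) : TangentPlane x →L[ℝ] TangentPlane x :=
  hess (fun z => cost z (transport x p)) x

/-- The mixed second derivative `D²_{xy} c(x,y)`, as a linear map from the tangent plane at `x` to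
the tangent plane at `y`. -/
def mixedHess (x y : S2) : TangentPlane x →L[ℝ] TangentPlane y :=
  fderiv ℝ (fun v => grad (fun z => cost (expS x v) z) y) 0

/-- The absolute value of the determinant of a linear map between two Euclidean planes, with
respect to orthonormal bases of the two planes. -/
def absDet {x y : S2} (L : TangentPlane x →L[ℝ] TangentPlane y) : ℝ :=
  Real.sqrt (ContinuousLinearMap.det (ContinuousLinearMap.adjoint L ∘L L))

/-- `H(x,p) = |det D²_{xy} c(x, T(x,p))| f₁(x) / f₂(T(x,p))`. -/
def coeffH (f₁ f₂ : S2 → ℝ) (x : S2) (p : TangentPlane x) : ℝ :=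
  absDet (mixedHess x (transport x p)) * f₁ x / f₂ (transport x p)

/-! ### Second order jets -/

/-- A point of the space on which a second order operator on the sphere is defined: a point `x`,
a tangent vector `p` at `x`, and a symmetric endomorphism `M` of the tangent plane at `x`. -/
structure Jet where
  x : S2
  p : TangentPlane x
  M : TangentPlane x →L[ℝ] TangentPlane x
  symm : (M : TangentPlane x →ₗ[ℝ] TangentPlane x).IsSymmetric

/-- A jet seen in the ambient space; `M` is extended by zero on the normal line. -/
def Jet.toAmbient (j : Jet) : E3 × E3 × (E3 →L[ℝ] E3) :=
  (j.x, j.p,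
    (TangentPlane j.x).subtypeL ∘L j.M ∘L (TangentPlane j.x).orthogonalProjectionOnto)

/-- The natural topology of the bundle of jets, induced from the ambient space. -/
instance : TopologicalSpace Jet := TopologicalSpace.induced Jet.toAmbient inferInstance

/-- The lower semicontinuous envelope `F_*`. -/
def lowerEnv (F : Jet → ℝ) (j : Jet) : EReal := Filter.liminf (fun z => (F z : EReal)) (𝓝 j)

/-- The upper semicontinuous envelope `F^*`. -/
def upperEnv (F : Jet → ℝ) (j : Jet) : EReal := Filter.limsup (fun z => (F z : EReal)) (𝓝 j)

/-! Smoothness of the exponential map, which gives the symmetry of the Hessian. -/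

theorem exists_contDiff_series (c : ℕ → ℝ) (hc : ∀ n, c n ≠ 0)
    (h : Filter.Tendsto (fun n => ‖c n.succ‖ / ‖c n‖) Filter.atTop (𝓝 0)) :
    ContDiff ℝ ∞ (fun t : ℝ => ∑' n, c n * t ^ n) := by
  have hr := FormalMultilinearSeries.ofScalars_radius_eq_top_of_tendsto (E := ℝ) (c := c)
    (Filter.Eventually.of_forall hc) h
  have hs := (FormalMultilinearSeries.ofScalars ℝ c).hasFPowerSeriesOnBall (by rw [hr]; simp)
  rw [hr] at hs
  have hd : ContDiff ℝ ∞ (FormalMultilinearSeries.ofScalars ℝ c).sum := by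
    rw [contDiff_iff_contDiffAt]
    intro x
    exact (hs.analyticAt_of_mem (by simp)).contDiffAt
  have he : (fun t : ℝ => ∑' n, c n * t ^ n) = (FormalMultilinearSeries.ofScalars ℝ c).sum := by
    funext t
    simpa [FormalMultilinearSeries.ofScalarsSum] using
      (FormalMultilinearSeries.ofScalars_sum_eq c t).symm
  rw [he]
  exact hd

theorem tendsto_ratio (a : ℕ → ℕ) (ha : ∀ n, a n < a (n + 1)) :
    Filter.Tendsto (fun n : ℕ => ‖(-1 : ℝ) ^ n.succ / ((a n.succ).factorial : ℝ)‖ /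
      ‖(-1 : ℝ) ^ n / ((a n).factorial : ℝ)‖) Filter.atTop (𝓝 0) := by
  refine squeeze_zero (fun n => by positivity) (fun n => ?_)
    (tendsto_one_div_add_atTop_nhds_zero_nat (𝕜 := ℝ))
  have hn : ∀ n, n ≤ a n := fun n => by
    induction n with
    | zero => omega
    | succ k ih => have := ha k; omega
  have h1 : (n + 1) * (a n).factorial ≤ (a n.succ).factorial :=
    calc (n + 1) * (a n).factorial ≤ (a n + 1) * (a n).factorial := by gcongr; exact hn n
      _ = (a n + 1).factorial := (Nat.factorial_succ _).symm
      _ ≤ _ := Nat.factorial_le (ha n)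
  have h2 : ((n : ℝ) + 1) * ((a n).factorial : ℝ) ≤ ((a n.succ).factorial : ℝ) := by
    exact_mod_cast h1
  have h3 : (0 : ℝ) < ((a n).factorial : ℝ) := by positivity
  have h4 : (0 : ℝ) < ((a n.succ).factorial : ℝ) := by positivity
  simp only [norm_div, norm_pow, norm_neg, norm_one, one_pow, Real.norm_natCast]
  rw [div_div_div_eq, one_mul, mul_one, div_le_div_iff₀ h4 (by positivity)]
  linarith

theorem contDiff_cos_norm {V : Type*} [NormedAddCommGroup V] [InnerProductSpace ℝ V] :
    ContDiff ℝ ∞ (fun v : V => Real.cos ‖v‖) := by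
  have h := exists_contDiff_series (fun n => (-1) ^ n / ((2 * n).factorial : ℝ))
    (fun n => by simp [Nat.factorial_ne_zero]) (tendsto_ratio (fun n => 2 * n) fun n => by omega)
  have he : (fun v : V => Real.cos ‖v‖) =
      (fun t : ℝ => ∑' n, ((-1) ^ n / ((2 * n).factorial : ℝ)) * t ^ n) ∘ fun v : V => ‖v‖ ^ 2 := by
    funext v
    rw [Function.comp_apply, ← (Real.hasSum_cos ‖v‖).tsum_eq]
    exact tsum_congr fun n => by rw [← pow_mul]; ring
  rw [he]
  exact h.comp (contDiff_norm_sq ℝ)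

theorem contDiff_sinc_norm {V : Type*} [NormedAddCommGroup V] [InnerProductSpace ℝ V] :
    ContDiff ℝ ∞ (fun v : V => Real.sinc ‖v‖) := by
  have h := exists_contDiff_series (fun n => (-1) ^ n / ((2 * n + 1).factorial : ℝ))
    (fun n => by simp [Nat.factorial_ne_zero]) (tendsto_ratio (fun n => 2 * n + 1) fun n => by omega)
  have he : (fun v : V => Real.sinc ‖v‖) =
      (fun t : ℝ => ∑' n, ((-1) ^ n / ((2 * n + 1).factorial : ℝ)) * t ^ n) ∘
        fun v : V => ‖v‖ ^ 2 := by
    funext v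
    rw [Function.comp_apply]
    by_cases hv : ‖v‖ = 0
    · rw [hv, Real.sinc_zero, tsum_eq_single 0 (fun n hn => by simp [hn])]
      simp
    · rw [Real.sinc_of_ne_zero hv, ← (Real.hasSum_sin ‖v‖).tsum_eq, ← tsum_div_const]
      exact tsum_congr fun n => by rw [← pow_mul]; field_simp; ring
  rw [he]
  exact h.comp (contDiff_norm_sq ℝ)

instance : Fact (Module.finrank ℝ E3 = 2 + 1) := ⟨by simp⟩

theorem contMDiff_expS (x : S2) : ContMDiff 𝓘(ℝ, TangentPlane x) (𝓡 2) ∞ (expS x) := by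
  have h : ContDiff ℝ ∞ (fun v : TangentPlane x =>
      Real.cos ‖v‖ • (x : E3) + Real.sinc ‖v‖ • (v : E3)) :=
    (contDiff_cos_norm.smul contDiff_const).add
      (contDiff_sinc_norm.smul (TangentPlane x).subtypeL.contDiff)
  exact ContMDiff.codRestrict_sphere (n := 2) h.contMDiff (exp_mem x)

theorem hess_isSymmetric {u : S2 → ℝ} (hu : ContMDiff (𝓡 2) 𝓘(ℝ, ℝ) ∞ u) (x : S2) :
    (hess u x : TangentPlane x →ₗ[ℝ] TangentPlane x).IsSymmetric := by
  have hf : ContDiff ℝ ∞ (inNormalCoords u x) := (hu.comp (contMDiff_expS x)).contDiff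
  have hs : IsSymmSndFDerivAt ℝ (inNormalCoords u x) 0 :=
    hf.contDiffAt.isSymmSndFDerivAt (by simp; norm_cast)
  have hd : DifferentiableAt ℝ (fderiv ℝ (inNormalCoords u x)) 0 :=
    ((hf.fderiv_right (m := 1) (by norm_cast)).differentiable (by simp)) 0
  let L : (TangentPlane x →L[ℝ] ℝ) →L[ℝ] TangentPlane x := LinearMap.toContinuousLinearMap
    { toFun := fun l => (InnerProductSpace.toDual ℝ (TangentPlane x)).symm l
      map_add' := by simp
      map_smul' := by simp }
  have hL : gradient (inNormalCoords u x) = fun v => L (fderiv ℝ (inNormalCoords u x) v) := rfl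
  have key : ∀ v w, inner ℝ (hess u x v) w = fderiv ℝ (fderiv ℝ (inNormalCoords u x)) 0 v w := by
    intro v w
    have h : fderiv ℝ (fun v => L (fderiv ℝ (inNormalCoords u x) v)) 0 =
        L ∘L fderiv ℝ (fderiv ℝ (inNormalCoords u x)) 0 := by
      rw [fderiv_fun_comp (0 : TangentPlane x) L.differentiableAt hd, L.fderiv]
    rw [hess, hL, h]
    exact InnerProductSpace.toDual_symm_apply
  intro v w
  rw [ContinuousLinearMap.coe_coe, key, real_inner_comm, key]
  exact hs v w

/-- The second order jet of a smooth function at a point of the sphere. -/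
def jetOf (φ : S2 → ℝ) (hφ : ContMDiff (𝓡 2) 𝓘(ℝ, ℝ) ∞ φ) (x : S2) : Jet :=
  ⟨x, grad φ x, hess φ x, hess_isSymmetric hφ x⟩

/-! ### Viscosity solutions -/

/-- `u` is a viscosity sub-solution of `F(x, ∇u, D²u) = 0`, where `𝓔` is the set of functions on
which `F` is elliptic. -/
def IsViscositySubsolution (F : Jet → ℝ) (𝓔 : Set (S2 → ℝ)) (u : S2 → ℝ) : Prop :=
  UpperSemicontinuous u ∧
    ∀ (x₀ : S2) (φ : S2 → ℝ) (hφ : ContMDiff (𝓡 2) 𝓘(ℝ, ℝ) ∞ φ), φ ∈ 𝓔 →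
      IsLocalMax (fun x => u x - φ x) x₀ → lowerEnv F (jetOf φ hφ x₀) ≤ 0

/-- `u` is a viscosity super-solution of `F(x, ∇u, D²u) = 0`, where `𝓔` is the set of functions on
which `F` is elliptic. -/
def IsViscositySupersolution (F : Jet → ℝ) (𝓔 : Set (S2 → ℝ)) (u : S2 → ℝ) : Prop :=
  LowerSemicontinuous u ∧
    ∀ (x₀ : S2) (φ : S2 → ℝ) (hφ : ContMDiff (𝓡 2) 𝓘(ℝ, ℝ) ∞ φ), φ ∈ 𝓔 →
      IsLocalMin (fun x => u x - φ x) x₀ → 0 ≤ upperEnv F (jetOf φ hφ x₀)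

/-- `u` is a viscosity solution of `F(x, ∇u, D²u) = 0`. -/
def IsViscositySolution (F : Jet → ℝ) (𝓔 : Set (S2 → ℝ)) (u : S2 → ℝ) : Prop :=
  Continuous u ∧ IsViscositySubsolution F 𝓔 u ∧ IsViscositySupersolution F 𝓔 u

/-! ### The optimal transport equation and the modified equation -/

/-- `F(x,p,M) = -det(M + A(x,p)) + H(x,p)`. -/
def opF (f₁ f₂ : S2 → ℝ) (j : Jet) : ℝ :=
  -(j.M + coeffA j.x j.p).det + coeffH f₁ f₂ j.x j.p

/-- The set of `C²` functions on which `F` is elliptic. -/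
def ellipticF : Set (S2 → ℝ) :=
  {φ | ContMDiff (𝓡 2) 𝓘(ℝ, ℝ) 2 φ ∧ ∀ x, (hess φ x + coeffA x (grad φ x)).IsPositive}

/-- `detPlus` is a modified determinant: it is the determinant on positive semidefinite
endomorphisms of the tangent planes, and negative on all others. -/
def IsModifiedDet (detPlus : (x : S2) → (TangentPlane x →L[ℝ] TangentPlane x) → ℝ) : Prop :=
  ∀ (x : S2) (M : TangentPlane x →L[ℝ] TangentPlane x),
    (M.IsPositive → detPlus x M = M.det) ∧ (¬ M.IsPositive → detPlus x M < 0)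

/-- `F⁺(x,p,M) = -det⁺(M + A(x,p)) + H(x,p)`. -/
def opFPlus (detPlus : (x : S2) → (TangentPlane x →L[ℝ] TangentPlane x) → ℝ)
    (f₁ f₂ : S2 → ℝ) (j : Jet) : ℝ :=
  -detPlus j.x (j.M + coeffA j.x j.p) + coeffH f₁ f₂ j.x j.p

/-- `G(x,p,M) = max {F⁺(x,p,M), |p| - R}`. -/
def opG (detPlus : (x : S2) → (TangentPlane x →L[ℝ] TangentPlane x) → ℝ)
    (f₁ f₂ : S2 → ℝ) (R : ℝ) (j : Jet) : ℝ :=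
  max (opFPlus detPlus f₁ f₂ j) (‖j.p‖ - R)

/-- The operator `G` is elliptic on all `C²` functions. -/
def ellipticG : Set (S2 → ℝ) := {φ | ContMDiff (𝓡 2) 𝓘(ℝ, ℝ) 2 φ}

/-! ### Data and `c`-convexity -/

/-- The surface measure of the unit sphere. -/
def surfaceMeasure : MeasureTheory.Measure S2 :=
  (MeasureTheory.volume : MeasureTheory.Measure E3).toSphere

/-- The conditions on the data: `f₁` and `f₂` are densities of equal mass, `f₂` is bounded away
from zero, and `f₁` is in `L^p` for some `p ≥ 1`. -/
structure NonsmoothData (f₁ f₂ : S2 → ℝ) : Prop where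
  nonneg : ∀ x, 0 ≤ f₁ x
  lower_bound : ∃ m : ℝ, 0 < m ∧ ∀ x, m ≤ f₂ x
  memLp : ∃ p : ENNReal, 1 ≤ p ∧ MeasureTheory.MemLp f₁ p surfaceMeasure
  integrable : MeasureTheory.Integrable f₂ surfaceMeasure
  mass_balance : ∫ x, f₁ x ∂surfaceMeasure = ∫ y, f₂ y ∂surfaceMeasure

/-- `u` is `c`-convex: `u(x) = sup_y (-c(x,y) - ψ(y))` for some `ψ`. -/
def IsCConvex (u : S2 → ℝ) : Prop :=
  ∃ ψ : S2 → ℝ, ∀ x, IsLUB (Set.range fun y => -cost x y - ψ y) (u x)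

end SphereOT

end

noncomputable section

namespace SphereOT

/-! ### The cost as a smooth function of the inner product -/

/-! Call a jet (x, p, M) strictly elliptic if |p| < π and M + A(x,p) > 0. This condition is open,
and on such jets F⁺ = F while |p| - R < 0. There G is the maximum of F and a negative number, so the
envelope inequalities for F pass to G. The equation for F, however, is tested only with functions
elliptic on the whole sphere, whereas G is tested with all smooth functions. Two facts bridge this
gap.

The first is that c-convexity restricts the jets of functions touching u. If u - φ has a local
maximum at x, a compactness argument gives y with φ + c(·,y) minimal at x. Then y is not antipodal
to x, because -c(·,y) has a convex cone at the antipode of y. Hence ∇φ = log_x y has length less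
than π and D²φ + A ≥ 0 (`IsCConvex.elliptic_of_isLocalMax`). If u - φ has a local minimum, u being
π-Lipschitz gives |∇φ| ≤ π.

The second, which is the core, is that every strictly elliptic jet is the jet of a globally elliptic
smooth function (`exists_ellipticF_jet`). The natural candidate -c(·,y) is only degenerate elliptic
and is singular at -y. Shrinking the chord |z - y| by a factor k < 1 and multiplying by μ ≤ 1 makes
it smooth and elliptic with margin 1 - k everywhere (`contracted_cost_elliptic`). With κ, k, μ near
1 its gradient at x₀ is exactly p and its Hessian is nearly -A. The missing positive Hessian B is
added by ε√(ε² + ⟨Bz,z⟩), whose Hessian at the kernel point x₀ is B for every ε, while its gradient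
and the negative part of its Hessian are O(ε) on the whole sphere.

For a subsolution, D²φ is replaced by D²φ + δI, the jet is realized by an elliptic ψ, F is tested
with ψ, and δ tends to 0 by semicontinuity of the envelope. For a supersolution D²φ - δI is used. If
the jet is not strictly elliptic, the shifted form is negative in some direction, so det⁺ < 0 and G
≥ 0 at once. If |∇φ| = π, jets with slightly shorter gradient are nonelliptic, since the eigenvalue
r cot r of A orthogonal to p tends to -∞ as r increases to π. -/

theorem exists_contDiff_cos_sqrt :
    ∃ c : ℝ → ℝ, ContDiff ℝ ∞ c ∧ ∀ r, c (r ^ 2) = Real.cos r := by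
  refine ⟨_, exists_contDiff_series (fun n => (-1) ^ n / ((2 * n).factorial : ℝ))
    (fun n => by simp [Nat.factorial_ne_zero])
    (tendsto_ratio (fun n => 2 * n) fun n => by omega), fun r => ?_⟩
  rw [← (Real.hasSum_cos r).tsum_eq]
  exact tsum_congr fun n => by rw [← pow_mul]; ring

/-- cos r is a smooth function of r² with nonzero derivative at r² = 0, so the inverse function
theorem makes r² a smooth function of cos r near 1, although `arccos` itself is not differentiable
there. -/
theorem exists_contDiffAt_arccos_sq :
    ∃ g : ℝ → ℝ, ContDiffAt ℝ ∞ g 1 ∧ ∀ᶠ t in 𝓝 (1 : ℝ), t ≤ 1 → g t = Real.arccos t ^ 2 := by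
  obtain ⟨c, hc, hcos⟩ := exists_contDiff_cos_sqrt
  have hc0 : c 0 = 1 := by simpa using hcos 0
  have hd : HasDerivAt c (deriv c 0) 0 := ((hc.differentiable (by simp)) 0).hasDerivAt
  have hne : deriv c 0 ≠ 0 := by
    have hlim := hd.tendsto_slope_zero_right
    -- The quadratic bound cos r ≤ 1 - 2r²/π² keeps the right slopes of c at 0 below a negative
    -- constant.
    have hle : deriv c 0 ≤ -(2 / Real.pi ^ 2) := by
      refine le_of_tendsto hlim ?_
      have hpi : ∀ᶠ w in 𝓝[>] (0 : ℝ), w < Real.pi ^ 2 :=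
        nhdsWithin_le_nhds (gt_mem_nhds (by positivity))
      filter_upwards [self_mem_nhdsWithin, hpi] with w hw hwpi
      have hw : 0 < w := hw
      have h1 : c w = Real.cos (√w) := by rw [← hcos, Real.sq_sqrt hw.le]
      have h2 : |√w| ≤ Real.pi := by
        rw [abs_of_nonneg (Real.sqrt_nonneg _)]
        exact (Real.sqrt_le_left Real.pi_pos.le).2 hwpi.le
      have h3 := Real.cos_le_one_sub_mul_cos_sq h2
      rw [Real.sq_sqrt hw.le] at h3
      rw [zero_add, hc0, h1, smul_eq_mul, inv_mul_le_iff₀ hw]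
      linarith
    have : 0 < 2 / Real.pi ^ 2 := by positivity
    linarith
  have hcd : ContDiffAt ℝ ∞ c 0 := hc.contDiffAt
  have hf : HasFDerivAt c (ContinuousLinearEquiv.unitsEquivAut ℝ (Units.mk0 _ hne) : ℝ →L[ℝ] ℝ) 0 := by
    have he : (ContinuousLinearEquiv.unitsEquivAut ℝ (Units.mk0 _ hne) : ℝ →L[ℝ] ℝ) =
        ContinuousLinearMap.toSpanSingleton ℝ (deriv c 0) := by ext; simp
    rw [he]
    exact hd.hasFDerivAt
  have hinv := hcd.to_localInverse hf (by simp)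
  rw [hc0] at hinv
  refine ⟨_, hinv, ?_⟩
  have hleft := (hcd.hasStrictFDerivAt' hf (by simp)).eventually_left_inverse
  have hcont : Filter.Tendsto (fun t : ℝ => Real.arccos t ^ 2) (𝓝 1) (𝓝 0) := by
    have h := (Real.continuous_arccos.pow 2).tendsto 1
    rw [Pi.pow_apply, Real.arccos_one, zero_pow two_ne_zero] at h
    exact h
  filter_upwards [hcont.eventually hleft, lt_mem_nhds (show (-1 : ℝ) < 1 by norm_num)]
    with t ht ht1 ht2
  rw [hcos, Real.cos_arccos ht1.le ht2] at ht
  exact ht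

/-- The squared geodesic cost as a function of the inner product, extended smoothly past `1`. -/
def costProfile (t : ℝ) : ℝ :=
  if t ≤ 1 then Real.arccos t ^ 2 / 2 else exists_contDiffAt_arccos_sq.choose t / 2

theorem contDiffAt_costProfile {t : ℝ} (h1 : -1 < t) (h2 : t ≤ 1) :
    ContDiffAt ℝ ∞ costProfile t := by
  rcases h2.lt_or_eq with h | rfl
  · have : ContDiffAt ℝ ∞ (fun t => Real.arccos t ^ 2 / 2) t :=
      ((Real.contDiffAt_arccos h1.ne' h.ne).pow 2).div_const 2
    refine this.congr_of_eventuallyEq ?_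
    filter_upwards [gt_mem_nhds h] with s hs
    simp [costProfile, hs.le]
  · obtain ⟨hg, he⟩ := exists_contDiffAt_arccos_sq.choose_spec
    refine (hg.div_const 2).congr_of_eventuallyEq ?_
    filter_upwards [he] with s hs
    unfold costProfile
    split_ifs with h
    · rw [hs h]
    · rfl

theorem differentiableAt_costProfile {t : ℝ} (h1 : -1 < t) (h2 : t ≤ 1) :
    DifferentiableAt ℝ costProfile t :=
  (contDiffAt_costProfile h1 h2).differentiableAt (by simp)

theorem contDiffAt_deriv_costProfile {t : ℝ} (h1 : -1 < t) (h2 : t ≤ 1) :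
    ContDiffAt ℝ ∞ (deriv costProfile) t := by
  have h : deriv costProfile = fun t => fderiv ℝ costProfile t 1 := by
    funext t; simp
  rw [h]
  exact ((contDiffAt_costProfile h1 h2).fderiv_right (m := ∞) (by norm_cast)).clm_apply
    contDiffAt_const

theorem contDiffAt_deriv_deriv_costProfile {t : ℝ} (h1 : -1 < t) (h2 : t ≤ 1) :
    ContDiffAt ℝ ∞ (deriv (deriv costProfile)) t := by
  have h : deriv (deriv costProfile) = fun t => fderiv ℝ (deriv costProfile) t 1 := by
    funext t; simp
  rw [h]
  exact ((contDiffAt_deriv_costProfile h1 h2).fderiv_right (m := ∞) (by norm_cast)).clm_apply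
    contDiffAt_const

theorem deriv_costProfile_of_lt {t : ℝ} (h1 : -1 < t) (h2 : t < 1) :
    deriv costProfile t = -(Real.arccos t / √(1 - t ^ 2)) := by
  have h := ((Real.hasDerivAt_arccos h1.ne' h2.ne).pow 2).div_const 2
  have he : costProfile =ᶠ[𝓝 t] fun t => Real.arccos t ^ 2 / 2 := by
    filter_upwards [gt_mem_nhds h2] with s hs
    simp [costProfile, hs.le]
  rw [he.deriv_eq]
  refine h.deriv.trans ?_
  simp; ring

/-- The derivative of the profile at cos θ is -θ / sin θ; the product form includes θ = 0, which is
reached by continuity. -/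
theorem deriv_costProfile_cos {θ : ℝ} (h0 : 0 ≤ θ) (h1 : θ < Real.pi) :
    deriv costProfile (Real.cos θ) * Real.sinc θ = -1 := by
  have hpos : ∀ s ∈ Set.Ioo 0 Real.pi, deriv costProfile (Real.cos s) * Real.sinc s = -1 := by
    rintro s ⟨hs0, hs1⟩
    have hsin := Real.sin_pos_of_pos_of_lt_pi hs0 hs1
    have hc := Real.sin_sq_add_cos_sq s
    rw [deriv_costProfile_of_lt (by nlinarith) (by nlinarith), Real.arccos_cos hs0.le hs1.le,
      ← Real.sin_sq, Real.sqrt_sq hsin.le, Real.sinc_of_ne_zero hs0.ne']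
    field_simp
  rcases h0.lt_or_eq with h | rfl
  · exact hpos θ ⟨h, h1⟩
  · have hc : ContinuousAt (fun s => deriv costProfile (Real.cos s) * Real.sinc s) 0 := by
      refine ContinuousAt.mul ?_ Real.continuous_sinc.continuousAt
      refine ContinuousAt.comp (g := deriv costProfile) ?_ Real.continuous_cos.continuousAt
      rw [Real.cos_zero]
      exact (contDiffAt_deriv_costProfile (by norm_num) le_rfl).continuousAt
    have hl := hc.tendsto.mono_left (nhdsWithin_le_nhds (s := Set.Ioi 0))
    refine tendsto_nhds_unique hl (tendsto_const_nhds.congr' ?_)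
    filter_upwards [Ioo_mem_nhdsGT Real.pi_pos] with s hs using (hpos s hs).symm

theorem deriv_costProfile_one : deriv costProfile 1 = -1 := by
  simpa using deriv_costProfile_cos le_rfl Real.pi_pos

theorem deriv_costProfile_neg {t : ℝ} (h1 : -1 < t) (h2 : t ≤ 1) : deriv costProfile t < 0 := by
  rcases h2.lt_or_eq with h | rfl
  · rw [deriv_costProfile_of_lt h1 h]
    have := Real.arccos_pos.2 h
    have : 0 < √(1 - t ^ 2) := Real.sqrt_pos.2 (by nlinarith)
    rw [neg_lt_zero]; positivity
  · rw [deriv_costProfile_one]; norm_num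

theorem deriv_costProfile_sq {t : ℝ} (h1 : -1 < t) (h2 : t ≤ 1) :
    deriv costProfile t ^ 2 * (1 - t ^ 2) = 2 * costProfile t := by
  rcases h2.lt_or_eq with h | rfl
  · have h3 : 0 < 1 - t ^ 2 := by nlinarith
    rw [deriv_costProfile_of_lt h1 h, neg_sq, div_pow, Real.sq_sqrt h3.le,
      div_mul_cancel₀ _ h3.ne', costProfile, if_pos h.le]
    ring
  · simp [costProfile]

/-- Differentiate the eikonal identity g'(t)² (1 - t²) = 2 g(t) and cancel the factor g', which is
negative. This ODE replaces all explicit second derivatives of the cost. -/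
theorem deriv_deriv_costProfile {t : ℝ} (h1 : -1 < t) (h2 : t ≤ 1) :
    deriv (deriv costProfile) t * (1 - t ^ 2) = 1 + deriv costProfile t * t := by
  rcases h2.lt_or_eq with h | rfl
  · have hd1 := (differentiableAt_costProfile h1 h.le).hasDerivAt
    have hd2 := ((contDiffAt_deriv_costProfile h1 h.le).differentiableAt (by simp)).hasDerivAt
    have hl := (hd2.pow 2).mul ((hasDerivAt_pow 2 t).const_sub 1)
    have hr := hd1.const_mul 2
    have he : (fun t => deriv costProfile t ^ 2 * (1 - t ^ 2)) =ᶠ[𝓝 t]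
        fun t => 2 * costProfile t := by
      filter_upwards [gt_mem_nhds h, lt_mem_nhds h1] with s hs hs1
        using deriv_costProfile_sq hs1 hs.le
    have key := (hr.congr_of_eventuallyEq he).unique hl
    have hne := (deriv_costProfile_neg h1 h.le).ne
    simp at key
    apply mul_left_cancel₀ hne
    linarith
  · rw [deriv_costProfile_one]; norm_num

/-! ### Geodesic distance and cost in terms of inner products. -/

theorem norm_coe_sphere (x : S2) : ‖(x : E3)‖ = 1 := by simp

theorem inner_self_sphere (x : S2) : inner ℝ (x : E3) (x : E3) = 1 := by
  rw [real_inner_self_eq_norm_sq, norm_coe_sphere]; norm_num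

theorem abs_inner_sphere_le (x y : S2) : |inner ℝ (x : E3) (y : E3)| ≤ 1 := by
  simpa using abs_real_inner_le_norm (x : E3) (y : E3)

theorem geoDist_eq_arccos (x y : S2) : geoDist x y = Real.arccos (inner ℝ (x : E3) (y : E3)) := by
  have hab := abs_le.1 (abs_inner_sphere_le x y)
  set a := inner ℝ (x : E3) (y : E3) with ha
  have h0 := Real.arccos_nonneg a
  have h1 := Real.arccos_le_pi a
  have hn : ‖(x : E3) - (y : E3)‖ ^ 2 = 2 - 2 * a := by
    rw [norm_sub_sq_real, norm_coe_sphere, norm_coe_sphere]; ring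
  have hs : ‖(x : E3) - (y : E3)‖ / 2 = Real.sin (Real.arccos a / 2) := by
    have h2 : 0 ≤ Real.sin (Real.arccos a / 2) :=
      Real.sin_nonneg_of_nonneg_of_le_pi (by linarith) (by linarith)
    rw [← sq_eq_sq₀ (by positivity) h2, Real.sin_sq_eq_half_sub, div_pow, hn,
      show 2 * (Real.arccos a / 2) = Real.arccos a by ring, Real.cos_arccos hab.1 hab.2]
    ring
  rw [geoDist, hs, Real.arcsin_sin (by linarith) (by linarith)]
  ring

theorem cost_eq_costProfile (x y : S2) : cost x y = costProfile (inner ℝ (x : E3) (y : E3)) := by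
  rw [cost, geoDist_eq_arccos, costProfile, if_pos (abs_le.1 (abs_inner_sphere_le x y)).2]

/-! ### Second order jets along great circles -/

theorem coe_expS (x : S2) (v : TangentPlane x) :
    (expS x v : E3) = Real.cos ‖v‖ • (x : E3) + Real.sinc ‖v‖ • (v : E3) := rfl

theorem expS_zero (x : S2) : expS x 0 = x := by
  ext1; simp [coe_expS]

theorem sinc_mul_self (t : ℝ) : Real.sinc t * t = Real.sin t := by
  by_cases h : t = 0
  · simp [h]
  · rw [Real.sinc_of_ne_zero h]; field_simp

theorem coe_expS_smul (x : S2) {v : TangentPlane x} (hv : ‖v‖ = 1) (t : ℝ) :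
    (expS x (t • v) : E3) = Real.cos t • (x : E3) + Real.sin t • (v : E3) := by
  rw [coe_expS, norm_smul, hv, mul_one, Real.norm_eq_abs, Real.cos_abs]
  have : Real.sinc |t| = Real.sinc t := by
    rcases abs_choice t with h | h <;> simp [h, Real.sinc_neg]
  rw [this, Submodule.coe_smul, smul_smul, sinc_mul_self]

theorem inner_sphere_tangent (x : S2) (v : TangentPlane x) : inner ℝ (x : E3) (v : E3) = 0 :=
  Submodule.mem_orthogonal_singleton_iff_inner_right.1 v.2

theorem inner_tangent_sphere (x : S2) (v : TangentPlane x) : inner ℝ (v : E3) (x : E3) = 0 :=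
  Submodule.mem_orthogonal_singleton_iff_inner_left.1 v.2

theorem inner_expS_smul (x : S2) {v : TangentPlane x} (hv : ‖v‖ = 1) (t : ℝ) (y : E3) :
    inner ℝ (expS x (t • v) : E3) y =
      Real.cos t * inner ℝ (x : E3) y + Real.sin t * inner ℝ (v : E3) y := by
  rw [coe_expS_smul x hv, inner_add_left, real_inner_smul_left, real_inner_smul_left]

theorem inner_sphere_expS (x : S2) (p : TangentPlane x) :
    inner ℝ (x : E3) (expS x p : E3) = Real.cos ‖p‖ := by
  rw [coe_expS, inner_add_right, real_inner_smul_right, real_inner_smul_right,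
    inner_self_sphere, inner_sphere_tangent]
  ring

theorem inner_tangent_expS (x : S2) (v p : TangentPlane x) :
    inner ℝ (v : E3) (expS x p : E3) = Real.sinc ‖p‖ * inner ℝ (p : E3) (v : E3) := by
  rw [coe_expS, inner_add_right, real_inner_smul_right, real_inner_smul_right,
    inner_tangent_sphere, real_inner_comm]
  ring

/-- Along the unit speed geodesic through `x` in the direction `v` the function `u` has first
derivative `d₁` and second derivative `d₂` at `x`. -/
def HasJetAlong (u : S2 → ℝ) (x : S2) (v : TangentPlane x) (d₁ d₂ : ℝ) : Prop :=
  ∃ D : ℝ → ℝ, (∀ᶠ t in 𝓝 (0 : ℝ), HasDerivAt (fun s => u (expS x (s • v))) (D t) t) ∧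
    D 0 = d₁ ∧ HasDerivAt D d₂ 0

theorem HasJetAlong.add {u w : S2 → ℝ} {x : S2} {v : TangentPlane x} {a₁ a₂ b₁ b₂ : ℝ}
    (hu : HasJetAlong u x v a₁ a₂) (hw : HasJetAlong w x v b₁ b₂) :
    HasJetAlong (fun z => u z + w z) x v (a₁ + b₁) (a₂ + b₂) := by
  obtain ⟨D, h1, rfl, h3⟩ := hu
  obtain ⟨E, k1, rfl, k3⟩ := hw
  refine ⟨fun t => D t + E t, ?_, rfl, h3.add k3⟩
  filter_upwards [h1, k1] with t ht kt using ht.add kt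

theorem hasDerivAt_cos_add_sin (a b t : ℝ) :
    HasDerivAt (fun s => Real.cos s * a + Real.sin s * b) (-Real.sin t * a + Real.cos t * b) t :=
  ((Real.hasDerivAt_cos t).mul_const a).add ((Real.hasDerivAt_sin t).mul_const b)

theorem hasDerivAt_neg_sin_add_cos (a b t : ℝ) :
    HasDerivAt (fun s => -Real.sin s * a + Real.cos s * b)
      (-Real.cos t * a + -Real.sin t * b) t :=
  ((Real.hasDerivAt_sin t).neg.mul_const a).add ((Real.hasDerivAt_cos t).mul_const b)

/-- Along a unit speed great circle the inner product with y is a cos t + b sin t, so the jet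
follows from one-variable calculus. -/
theorem hasJetAlong_comp_inner {f f' : ℝ → ℝ} {f₂ : ℝ} {x : S2} {v : TangentPlane x}
    (hv : ‖v‖ = 1) (y : E3)
    (hf : ∀ᶠ s in 𝓝 (inner ℝ (x : E3) y), HasDerivAt f (f' s) s)
    (hf' : HasDerivAt f' f₂ (inner ℝ (x : E3) y)) :
    HasJetAlong (fun z => f (inner ℝ (z : E3) y)) x v
      (f' (inner ℝ (x : E3) y) * inner ℝ (v : E3) y)
      (f₂ * inner ℝ (v : E3) y ^ 2 - f' (inner ℝ (x : E3) y) * inner ℝ (x : E3) y) := by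
  set a := inner ℝ (x : E3) y
  set b := inner ℝ (v : E3) y
  refine ⟨fun t => f' (Real.cos t * a + Real.sin t * b) * (-Real.sin t * a + Real.cos t * b),
    ?_, by simp, ?_⟩
  · have hc : Filter.Tendsto (fun s => Real.cos s * a + Real.sin s * b) (𝓝 0) (𝓝 a) := by
      have := (hasDerivAt_cos_add_sin a b 0).continuousAt.tendsto
      simpa using this
    filter_upwards [hc.eventually hf] with t ht
    simp only [inner_expS_smul x hv]
    exact ht.comp t (hasDerivAt_cos_add_sin a b t)
  · have h1 : HasDerivAt (fun t => f' (Real.cos t * a + Real.sin t * b)) (f₂ * b) 0 := by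
      have h := (hasDerivAt_cos_add_sin a b 0)
      have := HasDerivAt.comp (h₂ := f') (h₂' := f₂) 0 (by simpa using hf') h
      refine this.congr_deriv ?_
      simp
    have h2 := h1.mul (hasDerivAt_neg_sin_add_cos a b 0)
    refine h2.congr_deriv ?_
    simp
    ring

theorem hasDerivAt_inner_smul {x : S2} {u : S2 → ℝ} {v : TangentPlane x} {t : ℝ}
    (h : DifferentiableAt ℝ (inNormalCoords u x) (t • v)) :
    HasDerivAt (fun s => u (expS x (s • v)))
      (inner ℝ (gradient (inNormalCoords u x) (t • v)) v) t := by
  have h1 := h.hasGradientAt.hasFDerivAt.comp_hasDerivAt t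
    ((hasDerivAt_id t).smul_const v)
  refine h1.congr_deriv ?_
  simp

theorem gradient_differentiableAt {E : Type*} [NormedAddCommGroup E] [InnerProductSpace ℝ E]
    [CompleteSpace E] {f : E → ℝ} {a : E} (hf : ContDiffAt ℝ 2 f a) :
    DifferentiableAt ℝ (gradient f) a := by
  have hd : DifferentiableAt ℝ (fderiv ℝ f) a :=
    (hf.fderiv_right (m := 1) (by norm_num)).differentiableAt (by simp)
  exact ((InnerProductSpace.toDual ℝ E).symm.toContinuousLinearEquiv.differentiableAt).comp a hd

theorem ContDiffAt.eventually_differentiableAt {E : Type*} [NormedAddCommGroup E]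
    [NormedSpace ℝ E] {f : E → ℝ} {a : E} (hf : ContDiffAt ℝ 2 f a) :
    ∀ᶠ z in 𝓝 a, DifferentiableAt ℝ f z := by
  filter_upwards [hf.eventually (by simp)] with z hz using hz.differentiableAt (by simp)

theorem tendsto_smul_zero {E : Type*} [NormedAddCommGroup E] [NormedSpace ℝ E] (v : E) :
    Filter.Tendsto (fun t : ℝ => t • v) (𝓝 0) (𝓝 0) := by
  have : Continuous (fun t : ℝ => t • v) := by fun_prop
  simpa using this.tendsto 0

theorem HasJetAlong.inner_grad {u : S2 → ℝ} {x : S2} {v : TangentPlane x} {d₁ d₂ : ℝ}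
    (hu : ContDiffAt ℝ 2 (inNormalCoords u x) 0) (h : HasJetAlong u x v d₁ d₂) :
    inner ℝ (grad u x) v = d₁ := by
  obtain ⟨D, h1, rfl, -⟩ := h
  have h2 := hasDerivAt_inner_smul (t := 0) (v := v) (u := u) (x := x)
    (by rw [zero_smul]; exact hu.differentiableAt (by simp))
  rw [zero_smul] at h2
  exact h2.unique h1.self_of_nhds

theorem hasJetAlong_self {u : S2 → ℝ} {x : S2} (v : TangentPlane x)
    (hu : ContDiffAt ℝ 2 (inNormalCoords u x) 0) :
    HasJetAlong u x v (inner ℝ (grad u x) v) (inner ℝ (hess u x v) v) := by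
  refine ⟨fun t => inner ℝ (gradient (inNormalCoords u x) (t • v)) v, ?_, by simp [grad], ?_⟩
  · filter_upwards [(tendsto_smul_zero v).eventually (ContDiffAt.eventually_differentiableAt hu)]
      with t ht using hasDerivAt_inner_smul ht
  · have h1 : HasFDerivAt (gradient (inNormalCoords u x)) (hess u x) ((0 : ℝ) • v) := by
      rw [zero_smul]; exact (gradient_differentiableAt hu).hasFDerivAt
    have h2 := h1.comp_hasDerivAt (0 : ℝ) ((hasDerivAt_id (0 : ℝ)).smul_const v)
    have h3 := h2.inner ℝ (hasDerivAt_const (0 : ℝ) v)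
    refine h3.congr_deriv ?_
    simp

theorem HasJetAlong.unique {u : S2 → ℝ} {x : S2} {v : TangentPlane x} {a₁ a₂ b₁ b₂ : ℝ}
    (h : HasJetAlong u x v a₁ a₂) (h' : HasJetAlong u x v b₁ b₂) : a₁ = b₁ ∧ a₂ = b₂ := by
  obtain ⟨D, h1, rfl, h3⟩ := h
  obtain ⟨E, k1, rfl, k3⟩ := h'
  have he : D =ᶠ[𝓝 0] E := by
    filter_upwards [h1, k1] with t ht kt using ht.unique kt
  exact ⟨he.self_of_nhds, (h3.congr_of_eventuallyEq he.symm).unique k3⟩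

theorem HasJetAlong.inner_hess {u : S2 → ℝ} {x : S2} {v : TangentPlane x} {d₁ d₂ : ℝ}
    (hu : ContDiffAt ℝ 2 (inNormalCoords u x) 0) (h : HasJetAlong u x v d₁ d₂) :
    inner ℝ (hess u x v) v = d₂ :=
  ((hasJetAlong_self v hu).unique h).2

/-- Only regularity near the centre is needed, so this applies to the cost, which is not smooth at
the antipode. -/
theorem hess_isSymmetric_of_contDiffAt {u : S2 → ℝ} {x : S2}
    (hf : ContDiffAt ℝ 2 (inNormalCoords u x) 0) :
    (hess u x : TangentPlane x →ₗ[ℝ] TangentPlane x).IsSymmetric := by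
  have hs : IsSymmSndFDerivAt ℝ (inNormalCoords u x) 0 := hf.isSymmSndFDerivAt (by simp)
  have hd : DifferentiableAt ℝ (fderiv ℝ (inNormalCoords u x)) 0 :=
    (hf.fderiv_right (m := 1) (by norm_num)).differentiableAt (by simp)
  have key : ∀ v w, inner ℝ (hess u x v) w = fderiv ℝ (fderiv ℝ (inNormalCoords u x)) 0 v w := by
    intro v w
    have h := (InnerProductSpace.toDual ℝ (TangentPlane x)).symm.toContinuousLinearEquiv.hasFDerivAt.comp
      (0 : TangentPlane x) hd.hasFDerivAt
    have h' : hess u x = _ := h.fderiv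
    rw [h']
    exact InnerProductSpace.toDual_symm_apply
  intro v w
  rw [ContinuousLinearMap.coe_coe, key, real_inner_comm, key]
  exact hs v w

theorem contDiffAt_inNormalCoords {u : S2 → ℝ} (hu : ContMDiff (𝓡 2) 𝓘(ℝ, ℝ) ∞ u) (x : S2)
    (v : TangentPlane x) : ContDiffAt ℝ 2 (inNormalCoords u x) v :=
  ((hu.comp (contMDiff_expS x)).contDiff.of_le (by norm_cast)).contDiffAt

/-! ### Quadratic forms on tangent planes -/

section QuadraticForms

variable {V : Type*} [NormedAddCommGroup V] [InnerProductSpace ℝ V]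

theorem eq_norm_smul_unit {w : V} (hw : w ≠ 0) : ‖‖w‖⁻¹ • w‖ = 1 ∧ w = ‖w‖ • (‖w‖⁻¹ • w) := by
  have : ‖w‖ ≠ 0 := norm_ne_zero_iff.2 hw
  refine ⟨by rw [norm_smul, norm_inv, norm_norm, inv_mul_cancel₀ this], ?_⟩
  rw [smul_smul, mul_inv_cancel₀ this, one_smul]

theorem inner_map_smul_self (T : V →L[ℝ] V) (c : ℝ) (v : V) :
    inner ℝ (T (c • v)) (c • v) = c ^ 2 * inner ℝ (T v) v := by
  rw [map_smul, real_inner_smul_left, real_inner_smul_right]; ring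

theorem isPositive_of_unit {T : V →L[ℝ] V} (hT : (T : V →ₗ[ℝ] V).IsSymmetric)
    (h : ∀ v, ‖v‖ = 1 → 0 ≤ inner ℝ (T v) v) : T.IsPositive := by
  refine ⟨hT, fun w => ?_⟩
  change 0 ≤ inner ℝ (T w) w
  by_cases hw : w = 0
  · simp [hw]
  · obtain ⟨h1, h2⟩ := eq_norm_smul_unit hw
    rw [h2, inner_map_smul_self]
    exact mul_nonneg (sq_nonneg _) (h _ h1)

/-- Polarization: second derivatives along unit speed geodesics determine the whole Hessian. -/
theorem eq_of_inner_unit {T S : V →L[ℝ] V} (hT : (T : V →ₗ[ℝ] V).IsSymmetric)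
    (hS : (S : V →ₗ[ℝ] V).IsSymmetric)
    (h : ∀ v, ‖v‖ = 1 → inner ℝ (T v) v = inner ℝ (S v) v) : T = S := by
  have hz : (T : V →ₗ[ℝ] V) - S = 0 := by
    refine (LinearMap.IsSymmetric.inner_map_self_eq_zero (hT.sub hS)).1 fun w => ?_
    by_cases hw : w = 0
    · simp [hw]
    · obtain ⟨h1, h2⟩ := eq_norm_smul_unit hw
      have h3 := h _ h1
      change inner ℝ (T w - S w) w = 0
      rw [h2, inner_sub_left, inner_map_smul_self T, inner_map_smul_self S, h3, sub_self]
  ext1 w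
  have := LinearMap.congr_fun hz w
  exact sub_eq_zero.1 this

end QuadraticForms

/-! ### The Hessian of the cost -/

/-- The quadratic form of `A(x,p)` on unit tangent vectors. -/
def costForm (p v : E3) : ℝ :=
  deriv (deriv costProfile) (Real.cos ‖p‖) * (Real.sinc ‖p‖ * inner ℝ p v) ^ 2 -
    deriv costProfile (Real.cos ‖p‖) * Real.cos ‖p‖

theorem neg_one_lt_cos_norm {r : ℝ} (h0 : 0 ≤ r) (hr : r < Real.pi) : -1 < Real.cos r := by
  rw [← Real.cos_pi]
  exact Real.cos_lt_cos_of_nonneg_of_le_pi h0 le_rfl hr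

theorem continuousAt_costForm {p v : E3} (hp : ‖p‖ < Real.pi) :
    ContinuousAt (fun z : E3 × E3 => costForm z.1 z.2) (p, v) := by
  have hc := neg_one_lt_cos_norm (norm_nonneg p) hp
  have h0 : ContinuousAt (fun z : E3 × E3 => Real.cos ‖z.1‖) (p, v) := by fun_prop
  have h1 : ContinuousAt (fun z : E3 × E3 => deriv costProfile (Real.cos ‖z.1‖)) (p, v) :=
    ContinuousAt.comp (g := deriv costProfile)
      (contDiffAt_deriv_costProfile hc (Real.cos_le_one _)).continuousAt h0
  have h2 : ContinuousAt (fun z : E3 × E3 => deriv (deriv costProfile) (Real.cos ‖z.1‖)) (p, v) :=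
    ContinuousAt.comp (g := deriv (deriv costProfile))
      (contDiffAt_deriv_deriv_costProfile hc (Real.cos_le_one _)).continuousAt h0
  have h3 : Continuous (fun z : E3 × E3 => (Real.sinc ‖z.1‖ * inner ℝ z.1 z.2) ^ 2) := by
    have := Real.continuous_sinc
    fun_prop
  exact (h2.mul h3.continuousAt).sub (h1.mul h0)

theorem contDiffAt_cost_inNormalCoords {x y : S2} (h : -1 < inner ℝ (x : E3) (y : E3)) :
    ContDiffAt ℝ 2 (inNormalCoords (fun z => cost z y) x) 0 := by
  have he : inNormalCoords (fun z => cost z y) x = costProfile ∘ fun v : TangentPlane x =>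
      inner ℝ (Real.cos ‖v‖ • (x : E3) + Real.sinc ‖v‖ • (v : E3)) (y : E3) := by
    funext v
    rw [inNormalCoords, cost_eq_costProfile]
    rfl
  have h1 : ContDiff ℝ ∞ (fun v : TangentPlane x =>
      inner ℝ (Real.cos ‖v‖ • (x : E3) + Real.sinc ‖v‖ • (v : E3)) (y : E3)) :=
    ((contDiff_cos_norm.smul contDiff_const).add
      (contDiff_sinc_norm.smul (TangentPlane x).subtypeL.contDiff)).inner ℝ contDiff_const
  rw [he]
  refine ContDiffAt.comp _ ?_ (h1.of_le (by norm_cast)).contDiffAt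
  simp only [norm_zero, Real.cos_zero, one_smul, Real.sinc_zero, Submodule.coe_zero, add_zero]
  exact (contDiffAt_costProfile h (abs_le.1 (abs_inner_sphere_le x y)).2).of_le (by norm_cast)

theorem hasDerivAt_costProfile {t : ℝ} (h1 : -1 < t) (h2 : t ≤ 1) :
    (∀ᶠ s in 𝓝 t, HasDerivAt costProfile (deriv costProfile s) s) ∧
      HasDerivAt (deriv costProfile) (deriv (deriv costProfile) t) t := by
  refine ⟨?_, ((contDiffAt_deriv_costProfile h1 h2).differentiableAt (by simp)).hasDerivAt⟩
  have := (contDiffAt_costProfile h1 h2).of_le (m := 2) (by norm_cast)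
  filter_upwards [ContDiffAt.eventually_differentiableAt this] with s hs using hs.hasDerivAt

theorem hasJetAlong_cost {x y : S2} (h : -1 < inner ℝ (x : E3) (y : E3)) {v : TangentPlane x}
    (hv : ‖v‖ = 1) :
    HasJetAlong (fun z => cost z y) x v
      (deriv costProfile (inner ℝ (x : E3) (y : E3)) * inner ℝ (v : E3) (y : E3))
      (deriv (deriv costProfile) (inner ℝ (x : E3) (y : E3)) * inner ℝ (v : E3) (y : E3) ^ 2 -
        deriv costProfile (inner ℝ (x : E3) (y : E3)) * inner ℝ (x : E3) (y : E3)) := by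
  simp only [cost_eq_costProfile]
  have := hasDerivAt_costProfile h (abs_le.1 (abs_inner_sphere_le x y)).2
  exact hasJetAlong_comp_inner hv y this.1 this.2

theorem inner_coeffA {x : S2} {p v : TangentPlane x} (hp : ‖p‖ < Real.pi) (hv : ‖v‖ = 1) :
    inner ℝ (coeffA x p v) v = costForm p v := by
  have h : -1 < inner ℝ (x : E3) (transport x p : E3) := by
    rw [transport, inner_sphere_expS]; exact neg_one_lt_cos_norm (norm_nonneg p) hp
  rw [coeffA, (hasJetAlong_cost h hv).inner_hess (contDiffAt_cost_inNormalCoords h), costForm,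
    transport, inner_sphere_expS, inner_tangent_expS]
  rfl

theorem coeffA_isSymmetric {x : S2} {p : TangentPlane x} (hp : ‖p‖ < Real.pi) :
    (coeffA x p : TangentPlane x →ₗ[ℝ] TangentPlane x).IsSymmetric := by
  refine hess_isSymmetric_of_contDiffAt (contDiffAt_cost_inNormalCoords ?_)
  rw [transport, inner_sphere_expS]; exact neg_one_lt_cos_norm (norm_nonneg p) hp

/-! ### Strict ellipticity of a contracted cost function -/

/-- Contracting the chord keeps the argument of the profile away from the antipodal value -1, where
it is singular. -/
theorem contracted_mem {k a : ℝ} (hk0 : 0 < k) (hk1 : k < 1) (ha : |a| ≤ 1) :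
    -1 < 1 - k ^ 2 + k ^ 2 * a ∧ 1 - k ^ 2 + k ^ 2 * a ≤ 1 := by
  obtain ⟨h1, h2⟩ := abs_le.1 ha
  have h3 : 0 < k ^ 2 := by positivity
  have h4 : k ^ 2 < 1 := by nlinarith
  constructor <;> nlinarith

/-- Contraction multiplies the slope, which for the cost is s = arccos a, by at most k. The eikonal
identity at τ is combined with k²(1 - a²) ≤ 1 - τ² and the monotonicity of `arccos`. -/
theorem sq_slope_contracted_le {k a : ℝ} (hk0 : 0 < k) (hk1 : k < 1) (ha : |a| ≤ 1) :
    (k ^ 2 * deriv costProfile (1 - k ^ 2 + k ^ 2 * a)) ^ 2 * (1 - a ^ 2) ≤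
      (k * Real.arccos a) ^ 2 := by
  obtain ⟨hτ1, hτ2⟩ := contracted_mem hk0 hk1 ha
  obtain ⟨h1, h2⟩ := abs_le.1 ha
  set τ := 1 - k ^ 2 + k ^ 2 * a with hτ
  have h3 : 0 < k ^ 2 := by positivity
  have h4 : k ^ 2 < 1 := by nlinarith
  have haτ : a ≤ τ := by nlinarith
  have hsq := deriv_costProfile_sq hτ1 hτ2
  rw [costProfile, if_pos hτ2] at hsq
  have hmono : Real.arccos τ ≤ Real.arccos a := Real.arccos_le_arccos haτ
  have h5 := Real.arccos_nonneg τ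
  have h6 : k ^ 2 * (1 - a ^ 2) ≤ 1 - τ ^ 2 := by

    calc k ^ 2 * (1 - a ^ 2) = k ^ 2 * (1 - a) * (1 + a) := by ring
      _ ≤ k ^ 2 * (1 - a) * (1 + τ) :=
        mul_le_mul_of_nonneg_left (by linarith) (mul_nonneg h3.le (sub_nonneg.2 h2))
      _ = 1 - τ ^ 2 := by rw [hτ]; ring
  calc (k ^ 2 * deriv costProfile τ) ^ 2 * (1 - a ^ 2)
      = k ^ 2 * (deriv costProfile τ ^ 2 * (k ^ 2 * (1 - a ^ 2))) := by ring
    _ ≤ k ^ 2 * (deriv costProfile τ ^ 2 * (1 - τ ^ 2)) := by gcongr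
    _ = k ^ 2 * Real.arccos τ ^ 2 := by rw [hsq]; ring
    _ ≤ k ^ 2 * Real.arccos a ^ 2 := by gcongr
    _ = _ := by ring

/-- The left side is the second derivative of the contracted cost along the great circle through y.
Multiplying by 1 + τ and using 1 - τ = k²(1 - a) lets the ODE eliminate the second derivative of the
profile. -/
theorem radial_second_derivative_le {k a : ℝ} (hk0 : 0 < k) (hk1 : k < 1) (ha : |a| ≤ 1) :
    k ^ 4 * deriv (deriv costProfile) (1 - k ^ 2 + k ^ 2 * a) * (1 - a ^ 2) -
      k ^ 2 * deriv costProfile (1 - k ^ 2 + k ^ 2 * a) * a ≤ k := by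
  obtain ⟨hτ1, hτ2⟩ := contracted_mem hk0 hk1 ha
  obtain ⟨h1, h2⟩ := abs_le.1 ha
  have hode := deriv_deriv_costProfile hτ1 hτ2
  have hneg := deriv_costProfile_neg hτ1 hτ2
  set τ := 1 - k ^ 2 + k ^ 2 * a with hτ
  set g := deriv costProfile τ
  set G := deriv (deriv costProfile) τ
  have h3 : 0 < k ^ 2 := by positivity
  have h4 : k ^ 2 < 1 := by nlinarith
  have haτ : a ≤ τ := by nlinarith
  have hpos : 0 < 1 + τ := by linarith
  have e1 : (k ^ 4 * G * (1 - a ^ 2) - k ^ 2 * g * a) * (1 + τ) =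
      k ^ 2 * ((1 + a) + g * (τ - a)) := by
    have e2 : k ^ 2 * (1 - a ^ 2) * (1 + τ) = (1 + a) * (1 - τ ^ 2) := by rw [hτ]; ring
    calc (k ^ 4 * G * (1 - a ^ 2) - k ^ 2 * g * a) * (1 + τ)
        = k ^ 2 * (G * (k ^ 2 * (1 - a ^ 2) * (1 + τ)) - g * a * (1 + τ)) := by ring
      _ = k ^ 2 * ((1 + a) * (G * (1 - τ ^ 2)) - g * a * (1 + τ)) := by rw [e2]; ring
      _ = _ := by rw [hode]; ring
  have h5 : g * (τ - a) ≤ 0 := mul_nonpos_of_nonpos_of_nonneg hneg.le (by linarith)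
  have h6 : k ^ 2 ≤ k := by nlinarith
  refine le_of_mul_le_mul_right ?_ hpos
  rw [e1]
  have h7 : (1 + a) + g * (τ - a) ≤ 1 + τ := by linarith
  calc k ^ 2 * ((1 + a) + g * (τ - a)) ≤ k ^ 2 * (1 + τ) := by gcongr
    _ ≤ k * (1 + τ) := by gcongr

theorem mul_sin_le_sin_mul {l s : ℝ} (hl0 : 0 ≤ l) (hl1 : l ≤ 1) (hs0 : 0 ≤ s)
    (hs1 : s ≤ Real.pi) : l * Real.sin s ≤ Real.sin (l * s) := by
  have h := strictConcaveOn_sin_Icc.concaveOn.2 (⟨le_rfl, Real.pi_pos.le⟩ : (0 : ℝ) ∈ Set.Icc 0 Real.pi)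
    (⟨hs0, hs1⟩ : s ∈ Set.Icc 0 Real.pi) (sub_nonneg.2 hl1) hl0 (by ring)
  simpa using h

/-- The right side equals (r / sin r) · sin(s - r) / sin s. The first factor is at least 1, and
concavity of sine bounds the second below by (s - r) / s ≥ 1 - k. -/
theorem tangential_le {k r s : ℝ} (hk0 : 0 < k) (hk1 : k < 1) (hr : 0 < r) (hs : s < Real.pi)
    (hrs : r ≤ k * s) :
    1 - k ≤ r * Real.cos r / Real.sin r - r * Real.cos s / Real.sin s := by
  have hs0 : 0 < s := (mul_pos_iff_of_pos_left hk0).1 (hr.trans_le hrs)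
  have hrlt : r < s := by nlinarith
  have hsr := Real.sin_pos_of_pos_of_lt_pi hr (by linarith)
  have hss := Real.sin_pos_of_pos_of_lt_pi hs0 hs
  have hl1 : (s - r) / s ≤ 1 := by rw [div_le_one hs0]; linarith
  have hl2 : 1 - k ≤ (s - r) / s := by rw [le_div_iff₀ hs0]; linarith
  have hl0 : 0 ≤ (s - r) / s := by linarith
  have h1 := mul_sin_le_sin_mul hl0 hl1 hs0.le hs.le
  rw [div_mul_cancel₀ _ hs0.ne', Real.sin_sub] at h1
  have h2 : (1 - k) * Real.sin s ≤ Real.sin s * Real.cos r - Real.cos s * Real.sin r :=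
    le_trans (by gcongr) h1
  have h3 : r * Real.cos r / Real.sin r - r * Real.cos s / Real.sin s =
      (r / Real.sin r) * ((Real.sin s * Real.cos r - Real.cos s * Real.sin r) / Real.sin s) := by
    field_simp
  have h4 : 1 - k ≤ (Real.sin s * Real.cos r - Real.cos s * Real.sin r) / Real.sin s := by
    rwa [le_div_iff₀ hss]
  have h5 : 1 ≤ r / Real.sin r := by
    rw [one_le_div hsr]; exact Real.sin_le hr.le
  rw [h3]
  nlinarith

/-- Here r is the gradient length of the contracted cost, a = ⟨x,y⟩ and b = ⟨v,y⟩. The form D² + A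
is diagonal in the radial direction and its orthogonal complement: A contributes 1 and r cot r
respectively, so the two preceding estimates give margin 1 - k in each. -/
theorem contracted_cost_elliptic {k μ a b r : ℝ} (hk0 : 0 < k) (hk1 : k < 1) (hμ0 : 0 ≤ μ)
    (hμ1 : μ ≤ 1) (ha : |a| ≤ 1) (hb : b ^ 2 ≤ 1 - a ^ 2) (hr0 : 0 ≤ r)
    (hr : r ^ 2 = (μ * k ^ 2 * deriv costProfile (1 - k ^ 2 + k ^ 2 * a)) ^ 2 * (1 - a ^ 2)) :
    r ≤ k * Real.pi ∧ 1 - k ≤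
      deriv (deriv costProfile) (Real.cos r) *
          (Real.sinc r * (-(μ * k ^ 2 * deriv costProfile (1 - k ^ 2 + k ^ 2 * a)) * b)) ^ 2 -
        deriv costProfile (Real.cos r) * Real.cos r +
      (-(μ * k ^ 4 * deriv (deriv costProfile) (1 - k ^ 2 + k ^ 2 * a)) * b ^ 2 +
        μ * k ^ 2 * deriv costProfile (1 - k ^ 2 + k ^ 2 * a) * a) := by
  obtain ⟨hτ1, hτ2⟩ := contracted_mem hk0 hk1 ha
  obtain ⟨h1, h2⟩ := abs_le.1 ha
  have hsq := sq_slope_contracted_le hk0 hk1 ha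
  have hrad := radial_second_derivative_le hk0 hk1 ha
  have hneg := deriv_costProfile_neg hτ1 hτ2
  have hg1 : a = 1 → deriv costProfile (1 - k ^ 2 + k ^ 2 * a) = -1 := by
    rintro rfl
    rw [show 1 - k ^ 2 + k ^ 2 * 1 = (1 : ℝ) by ring, deriv_costProfile_one]
  set τ := 1 - k ^ 2 + k ^ 2 * a with hτ
  set g := deriv costProfile τ
  set G := deriv (deriv costProfile) τ
  set s := Real.arccos a with hs
  have hs0 : 0 ≤ s := Real.arccos_nonneg a
  have hsπ : s ≤ Real.pi := Real.arccos_le_pi a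
  have hcos : Real.cos s = a := Real.cos_arccos h1 h2
  have hsin : Real.sin s ^ 2 = 1 - a ^ 2 := by rw [Real.sin_sq, hcos]
  have hrs : r ≤ k * s := by
    refine abs_le_of_sq_le_sq' ?_ (by positivity) |>.2
    calc r ^ 2 = μ ^ 2 * ((k ^ 2 * g) ^ 2 * (1 - a ^ 2)) := by rw [hr]; ring
      _ ≤ 1 * (k * s) ^ 2 := by
        have : μ ^ 2 ≤ 1 := by nlinarith
        have h0 : 0 ≤ 1 - a ^ 2 := by nlinarith
        gcongr
      _ = _ := one_mul _
  have hrk : r ≤ k * Real.pi := hrs.trans (by gcongr)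
  refine ⟨hrk, ?_⟩
  have hrπ : r < Real.pi := hrk.trans_lt (by nlinarith [Real.pi_pos])
  have hR := deriv_costProfile_cos hr0 hrπ
  have hode := deriv_deriv_costProfile (neg_one_lt_cos_norm hr0 hrπ) (Real.cos_le_one r)
  rcases (show 0 ≤ 1 - a ^ 2 by nlinarith).lt_or_eq with hS | hS
  · have hsinpos : 0 < Real.sin s := by
      have : 0 ≤ Real.sin s := Real.sin_nonneg_of_nonneg_of_le_pi hs0 hsπ
      rcases this.lt_or_eq with h | h
      · exact h
      · rw [← h] at hsin; linarith
    have hslt : s < Real.pi := by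
      rcases hsπ.lt_or_eq with h | h
      · exact h
      · rw [h, Real.sin_pi] at hsinpos; exact absurd hsinpos (lt_irrefl _)
    -- β is the squared cosine of the angle between v and the radial direction, so the form is the
    -- average of its radial and tangential values with weights β and 1 - β.
    set β := b ^ 2 / (1 - a ^ 2) with hβ
    have hbβ : b ^ 2 = β * (1 - a ^ 2) := by rw [hβ, div_mul_cancel₀ _ hS.ne']
    have hβ0 : 0 ≤ β := by positivity
    have hβ1 : β ≤ 1 := by rw [hβ, div_le_one hS]; exact hb
    have hA : deriv (deriv costProfile) (Real.cos r) * (Real.sinc r * (-(μ * k ^ 2 * g) * b)) ^ 2 =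
        β * (1 + deriv costProfile (Real.cos r) * Real.cos r) := by
      rw [← hode, ← Real.sin_sq, ← sinc_mul_self r]
      calc deriv (deriv costProfile) (Real.cos r) * (Real.sinc r * (-(μ * k ^ 2 * g) * b)) ^ 2
          = deriv (deriv costProfile) (Real.cos r) * Real.sinc r ^ 2 *
              ((μ * k ^ 2 * g) ^ 2 * b ^ 2) := by ring
        _ = deriv (deriv costProfile) (Real.cos r) * Real.sinc r ^ 2 * (β * r ^ 2) := by
          rw [hbβ, hr]; ring
        _ = _ := by ring
    have hT : 1 - k ≤ -(deriv costProfile (Real.cos r) * Real.cos r) + μ * k ^ 2 * g * a := by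
      have hrsin : r = -(μ * k ^ 2 * g) * Real.sin s := by
        have hnn : 0 ≤ -(μ * k ^ 2 * g) * Real.sin s := by
          refine mul_nonneg (neg_nonneg.2 ?_) hsinpos.le
          exact mul_nonpos_of_nonneg_of_nonpos (by positivity) hneg.le
        rw [← sq_eq_sq₀ hr0 hnn, hr, ← hsin]; ring
      rcases hr0.lt_or_eq with h | h
      · have ht := tangential_le hk0 hk1 h hslt hrs
        have hsr := Real.sin_pos_of_pos_of_lt_pi h hrπ
        have e1 : deriv costProfile (Real.cos r) = -(r / Real.sin r) := by
          rw [Real.sinc_of_ne_zero h.ne'] at hR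
          field_simp at hR ⊢
          linarith
        have e2 : μ * k ^ 2 * g = -(r / Real.sin s) := by
          field_simp
          linarith
        rw [e1, e2, ← hcos]
        convert ht using 1
        ring
      · have e2 : μ * k ^ 2 * g = 0 := by
          rw [← h] at hrsin
          rcases mul_eq_zero.1 hrsin.symm with h' | h'
          · linarith
          · exact absurd h' hsinpos.ne'
        rw [e2, ← h, Real.cos_zero, deriv_costProfile_one]
        linarith
    have hN : 1 - k ≤ 1 - μ * (k ^ 4 * G * (1 - a ^ 2) - k ^ 2 * g * a) := by
      have : μ * (k ^ 4 * G * (1 - a ^ 2) - k ^ 2 * g * a) ≤ k :=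
        calc _ ≤ μ * k := by gcongr
          _ ≤ 1 * k := by gcongr
          _ = k := one_mul k
      linarith
    rw [hA, hbβ]
    have := mul_le_mul_of_nonneg_left hN hβ0
    have := mul_le_mul_of_nonneg_left hT (sub_nonneg.2 hβ1)
    nlinarith
  -- Here a² = 1, so x = y or x = -y: the gradient vanishes and there is no radial direction.
  · have hb0 : b = 0 := by
      have : b ^ 2 ≤ 0 := by linarith
      exact pow_eq_zero_iff two_ne_zero |>.1 (le_antisymm this (sq_nonneg b))
    have hr00 : r = 0 := by
      rw [← hS, mul_zero] at hr
      exact pow_eq_zero_iff two_ne_zero |>.1 hr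
    rw [hb0, hr00, Real.cos_zero, deriv_costProfile_one]
    have ha' : a = 1 ∨ a = -1 := by
      rw [← sq_eq_one_iff]; linarith
    rcases ha' with h | h
    · rw [hg1 h, h]
      have : μ * k ^ 2 ≤ k := by nlinarith
      linarith
    · rw [h]
      have : μ * k ^ 2 * g ≤ 0 := mul_nonpos_of_nonneg_of_nonpos (by positivity) hneg.le
      linarith

/-! ### Building blocks of test functions -/

theorem ext_inner_unit {V : Type*} [NormedAddCommGroup V] [InnerProductSpace ℝ V] {p q : V}
    (h : ∀ v, ‖v‖ = 1 → inner ℝ p v = inner ℝ q v) : p = q := by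
  refine ext_inner_right ℝ fun w => ?_
  by_cases hw : w = 0
  · simp [hw]
  · obtain ⟨h1, h2⟩ := eq_norm_smul_unit hw
    rw [h2, real_inner_smul_right p, real_inner_smul_right q, h _ h1]

theorem norm_le_of_inner_unit {V : Type*} [NormedAddCommGroup V] [InnerProductSpace ℝ V] {p : V}
    {C : ℝ} (hC : 0 ≤ C) (h : ∀ v, ‖v‖ = 1 → inner ℝ p v ≤ C) : ‖p‖ ≤ C := by
  by_cases hp : p = 0
  · simpa [hp] using hC
  · obtain ⟨h1, -⟩ := eq_norm_smul_unit hp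
    have := h _ h1
    rw [real_inner_smul_right, real_inner_self_eq_norm_sq] at this
    have hn : ‖p‖ ≠ 0 := norm_ne_zero_iff.2 hp
    field_simp at this
    exact this

/-- The tangential part at `x` of the position vector of `y`. -/
def tangentPart (x y : S2) : TangentPlane x :=
  ⟨(y : E3) - (inner ℝ (x : E3) (y : E3)) • (x : E3), by
    rw [Submodule.mem_orthogonal_singleton_iff_inner_right, inner_sub_right,
      real_inner_smul_right, inner_self_sphere, mul_one, sub_self]⟩

theorem inner_tangentPart (x y : S2) (v : TangentPlane x) :
    inner ℝ (tangentPart x y) v = inner ℝ (v : E3) (y : E3) := by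
  rw [Submodule.coe_inner, tangentPart, inner_sub_left, real_inner_smul_left,
    inner_sphere_tangent, mul_zero, sub_zero, real_inner_comm]

theorem norm_tangentPart_sq (x y : S2) :
    ‖tangentPart x y‖ ^ 2 = 1 - inner ℝ (x : E3) (y : E3) ^ 2 := by
  rw [← Submodule.norm_coe, tangentPart, norm_sub_sq_real, norm_coe_sphere, norm_smul,
    norm_coe_sphere, real_inner_smul_right, real_inner_comm (x : E3) (y : E3), Real.norm_eq_abs,
    mul_one, sq_abs]
  ring

theorem inner_tangent_sq_le (x y : S2) {v : TangentPlane x} (hv : ‖v‖ = 1) :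
    inner ℝ (v : E3) (y : E3) ^ 2 ≤ 1 - inner ℝ (x : E3) (y : E3) ^ 2 := by
  rw [← inner_tangentPart, ← norm_tangentPart_sq]
  have := abs_real_inner_le_norm (tangentPart x y) v
  rw [hv, mul_one] at this
  rw [← sq_abs]
  gcongr

/-- A multiple of minus the cost with centre `y`, contracted so as to be smooth at `-y`. -/
def contractedCost (μ k : ℝ) (y : S2) (z : S2) : ℝ :=
  -(μ * costProfile (1 - k ^ 2 + k ^ 2 * inner ℝ (z : E3) (y : E3)))

theorem contMDiff_coe_S2 : ContMDiff (𝓡 2) 𝓘(ℝ, E3) ∞ ((↑) : S2 → E3) :=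
  contMDiff_coe_sphere

theorem contMDiff_contractedCost (μ : ℝ) {k : ℝ} (hk0 : 0 < k) (hk1 : k < 1) (y : S2) :
    ContMDiff (𝓡 2) 𝓘(ℝ, ℝ) ∞ (contractedCost μ k y) := by
  intro z
  obtain ⟨h1, h2⟩ := contracted_mem hk0 hk1 (abs_inner_sphere_le z y)
  have hi : ContDiffAt ℝ ∞ (fun w : E3 => 1 - k ^ 2 + k ^ 2 * inner ℝ w (y : E3)) z :=
    contDiffAt_const.add (contDiffAt_const.mul (contDiffAt_id.inner ℝ contDiffAt_const))
  have h : ContDiffAt ℝ ∞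
      (fun w : E3 => -(μ * costProfile (1 - k ^ 2 + k ^ 2 * inner ℝ w (y : E3)))) z :=
    (contDiffAt_const.mul (ContDiffAt.comp (g := costProfile) (z : E3)
      (contDiffAt_costProfile h1 h2) hi)).neg
  exact ContMDiffAt.comp (I' := 𝓘(ℝ, E3)) (g := fun w : E3 =>
    -(μ * costProfile (1 - k ^ 2 + k ^ 2 * inner ℝ w (y : E3)))) z h.contMDiffAt
    contMDiff_coe_S2.contMDiffAt

theorem hasJetAlong_contractedCost (μ : ℝ) {k : ℝ} (hk0 : 0 < k) (hk1 : k < 1) (y : S2) {x : S2}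
    {v : TangentPlane x} (hv : ‖v‖ = 1) {a τ : ℝ} (ha : inner ℝ (x : E3) (y : E3) = a)
    (hτ : τ = 1 - k ^ 2 + k ^ 2 * a) :
    HasJetAlong (contractedCost μ k y) x v
      (-(μ * k ^ 2 * deriv costProfile τ) * inner ℝ (v : E3) (y : E3))
      (-(μ * k ^ 4 * deriv (deriv costProfile) τ) * inner ℝ (v : E3) (y : E3) ^ 2 +
        μ * k ^ 2 * deriv costProfile τ * a) := by
  subst hτ
  obtain ⟨h1, h2⟩ := contracted_mem hk0 hk1 (abs_inner_sphere_le x y)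
  rw [ha] at h1 h2
  obtain ⟨hd1, hd2⟩ := hasDerivAt_costProfile h1 h2
  have hlin : ∀ s : ℝ, HasDerivAt (fun s => 1 - k ^ 2 + k ^ 2 * s) (k ^ 2) s := fun s => by
    simpa using ((hasDerivAt_id s).const_mul (k ^ 2)).const_add (1 - k ^ 2)
  have hf : ∀ᶠ s in 𝓝 a, HasDerivAt (fun s => -(μ * costProfile (1 - k ^ 2 + k ^ 2 * s)))
      (-(μ * (deriv costProfile (1 - k ^ 2 + k ^ 2 * s) * k ^ 2))) s := by
    filter_upwards [(hlin a).continuousAt.eventually hd1] with s hs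
    exact ((hs.comp s (hlin s)).const_mul μ).neg
  have hf' : HasDerivAt (fun s => -(μ * (deriv costProfile (1 - k ^ 2 + k ^ 2 * s) * k ^ 2)))
      (-(μ * (deriv (deriv costProfile) (1 - k ^ 2 + k ^ 2 * a) * k ^ 2 * k ^ 2))) a :=
    (((hd2.comp a (hlin a)).mul_const (k ^ 2)).const_mul μ).neg
  rw [← ha] at hf hf'
  have h := hasJetAlong_comp_inner hv (y : E3) hf hf'
  rw [ha] at h
  convert h using 1
  · rfl
  · ring
  · ring

theorem grad_contractedCost (μ : ℝ) {k : ℝ} (hk0 : 0 < k) (hk1 : k < 1) (x y : S2) :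
    grad (contractedCost μ k y) x =
      -(μ * k ^ 2 * deriv costProfile (1 - k ^ 2 + k ^ 2 * inner ℝ (x : E3) (y : E3))) •
        tangentPart x y := by
  refine ext_inner_unit fun v hv => ?_
  rw [(hasJetAlong_contractedCost μ hk0 hk1 y hv rfl rfl).inner_grad
    (contDiffAt_inNormalCoords (contMDiff_contractedCost μ hk0 hk1 y) x 0), real_inner_smul_left,
    inner_tangentPart]

theorem contractedCost_elliptic {k μ : ℝ} (hk0 : 0 < k) (hk1 : k < 1) (hμ0 : 0 ≤ μ) (hμ1 : μ ≤ 1)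
    (x y : S2) :
    ‖grad (contractedCost μ k y) x‖ ≤ k * Real.pi ∧ ∀ v : TangentPlane x, ‖v‖ = 1 →
      1 - k ≤ costForm (grad (contractedCost μ k y) x) v +
        inner ℝ (hess (contractedCost μ k y) x v) v := by
  have hg := grad_contractedCost μ hk0 hk1 x y
  have hr : ‖grad (contractedCost μ k y) x‖ ^ 2 = (μ * k ^ 2 * deriv costProfile
      (1 - k ^ 2 + k ^ 2 * inner ℝ (x : E3) (y : E3))) ^ 2 * (1 - inner ℝ (x : E3) (y : E3) ^ 2) := by
    rw [hg, norm_smul, mul_pow, norm_tangentPart_sq, Real.norm_eq_abs, sq_abs, neg_sq]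
  have ha := abs_inner_sphere_le x y
  refine ⟨(contracted_cost_elliptic (b := 0) hk0 hk1 hμ0 hμ1 ha ?_ (norm_nonneg _) hr).1,
    fun v hv => ?_⟩
  · have := abs_le.1 ha; nlinarith
  · have h := (contracted_cost_elliptic hk0 hk1 hμ0 hμ1 ha (inner_tangent_sq_le x y hv)
      (norm_nonneg _) hr).2
    rw [(hasJetAlong_contractedCost μ hk0 hk1 y hv rfl rfl).inner_hess
      (contDiffAt_inNormalCoords (contMDiff_contractedCost μ hk0 hk1 y) x 0), costForm,
      ← Submodule.coe_inner]
    have hin : inner ℝ (grad (contractedCost μ k y) x) v = -(μ * k ^ 2 * deriv costProfile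
        (1 - k ^ 2 + k ^ 2 * inner ℝ (x : E3) (y : E3))) * inner ℝ (v : E3) (y : E3) := by
      rw [hg, real_inner_smul_left, inner_tangentPart]
    rw [hin]
    exact h

/-- A smooth function on the sphere with small gradient, almost nonnegative Hessian, and Hessian
`B` at the points of the kernel of `B`. -/
def regularizedSeminorm (B : E3 →L[ℝ] E3) (ε : ℝ) (z : S2) : ℝ :=
  ε * √(ε ^ 2 + inner ℝ (B z) (z : E3))

theorem contMDiff_regularizedSeminorm {B : E3 →L[ℝ] E3} (hB0 : ∀ z, 0 ≤ inner ℝ (B z) z) {ε : ℝ}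
    (hε : 0 < ε) : ContMDiff (𝓡 2) 𝓘(ℝ, ℝ) ∞ (regularizedSeminorm B ε) := by
  have h1 : ContDiff ℝ ∞ (fun z : E3 => ε ^ 2 + inner ℝ (B z) z) :=
    contDiff_const.add (B.contDiff.inner ℝ contDiff_id)
  have h : ContDiff ℝ ∞ (fun z : E3 => ε * √(ε ^ 2 + inner ℝ (B z) z)) :=
    contDiff_const.mul (h1.sqrt fun z => by have := hB0 z; positivity)
  exact h.contMDiff.comp contMDiff_coe_S2

theorem inner_sq_le_of_nonneg {B : E3 →L[ℝ] E3} (hB : (B : E3 →ₗ[ℝ] E3).IsSymmetric)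
    (hB0 : ∀ z, 0 ≤ inner ℝ (B z) z) (x v : E3) :
    inner ℝ (B x) v ^ 2 ≤ inner ℝ (B x) x * inner ℝ (B v) v := by
  have h : ∀ t : ℝ, 0 ≤ inner ℝ (B v) v * (t * t) + 2 * inner ℝ (B x) v * t + inner ℝ (B x) x := by
    intro t
    have h1 := hB0 (x + t • v)
    have h2 : inner ℝ (B v) x = inner ℝ (B x) v := by
      rw [real_inner_comm]; exact (hB x v).symm
    simp only [map_add, map_smul, inner_add_left, inner_add_right, real_inner_smul_left,
      real_inner_smul_right, h2] at h1
    linarith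
  have := discrim_le_zero h
  rw [discrim] at this
  linarith

theorem hasJetAlong_regularizedSeminorm {B : E3 →L[ℝ] E3}
    (hB : (B : E3 →ₗ[ℝ] E3).IsSymmetric) (hB0 : ∀ z, 0 ≤ inner ℝ (B z) z) {ε : ℝ} (hε : 0 < ε)
    {x : S2} {v : TangentPlane x} (hv : ‖v‖ = 1) {s : ℝ}
    (hs : s = √(ε ^ 2 + inner ℝ (B x) (x : E3))) :
    HasJetAlong (regularizedSeminorm B ε) x v (ε * (inner ℝ (B x) (v : E3) / s))
      (ε * (((inner ℝ (B v) (v : E3) - inner ℝ (B x) (x : E3)) * s -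
        inner ℝ (B x) (v : E3) * (inner ℝ (B x) (v : E3) / s)) / s ^ 2)) := by
  subst hs
  set A := inner ℝ (B x) (x : E3)
  set b := inner ℝ (B x) (v : E3)
  set C := inner ℝ (B v) (v : E3)
  have hb : inner ℝ (B v) (x : E3) = b := by
    rw [real_inner_comm]; exact (hB x v).symm
  let q : ℝ → ℝ := fun t => ε ^ 2 + (Real.cos t ^ 2 * A + 2 * (Real.sin t * Real.cos t) * b +
    Real.sin t ^ 2 * C)
  let P : ℝ → ℝ := fun t => Real.sin t * Real.cos t * (C - A) + (Real.cos t ^ 2 - Real.sin t ^ 2) * b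
  have hq : ∀ t, ε ^ 2 + inner ℝ (B (expS x (t • v))) (expS x (t • v) : E3) = q t := by
    intro t
    rw [coe_expS_smul x hv]
    simp only [map_add, map_smul, inner_add_left, inner_add_right, real_inner_smul_left,
      real_inner_smul_right, hb, q]
    ring
  have hq0 : ∀ t, 0 < q t := by
    intro t
    rw [← hq]
    have := hB0 (expS x (t • v)); positivity
  have hsc : ∀ t, HasDerivAt (fun t => Real.sin t * Real.cos t) (Real.cos t ^ 2 - Real.sin t ^ 2) t := by
    intro t
    exact ((Real.hasDerivAt_sin t).mul (Real.hasDerivAt_cos t)).congr_deriv (by ring)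
  have hqd : ∀ t, HasDerivAt q (2 * P t) t := by
    intro t
    have h := (((((Real.hasDerivAt_cos t).pow 2).mul_const A).add
      (((hsc t).const_mul 2).mul_const b)).add
      (((Real.hasDerivAt_sin t).pow 2).mul_const C)).const_add (ε ^ 2)
    refine h.congr_deriv ?_
    simp only [P]
    push_cast
    ring
  have hPd : HasDerivAt P (C - A) 0 := by
    have h := ((hsc 0).mul_const (C - A)).add
      ((((Real.hasDerivAt_cos 0).pow 2).sub ((Real.hasDerivAt_sin 0).pow 2)).mul_const b)
    refine h.congr_deriv ?_
    simp
  have hq00 : q 0 = ε ^ 2 + A := by simp [q]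
  have hsq : ∀ t, HasDerivAt (fun t => √(q t)) (P t / √(q t)) t := by
    intro t
    refine ((hqd t).sqrt (hq0 t).ne').congr_deriv ?_
    have : √(q t) ≠ 0 := (Real.sqrt_pos.2 (hq0 t)).ne'
    field_simp
  refine ⟨fun t => ε * (P t / √(q t)), Filter.Eventually.of_forall fun t => ?_, ?_, ?_⟩
  · simp only [regularizedSeminorm, hq]
    exact (hsq t).const_mul ε
  · simp only [hq00]
    simp [P]
  · have h := (hPd.div (hsq 0) (Real.sqrt_pos.2 (hq0 0)).ne').const_mul ε
    have hP0 : P 0 = b := by simp [P]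
    rw [hq00, hP0] at h
    exact h

/-- Cauchy–Schwarz for B bounds the slope of √(ε² + ⟨Bz,z⟩) by √‖B‖ independently of ε. It also
makes the part of the second derivative coming from convexity nonnegative, leaving only the
curvature term -⟨Bx,x⟩/s ≥ -√‖B‖. The prefactor ε makes both bounds small. -/
theorem regularizedSeminorm_bounds {B : E3 →L[ℝ] E3}
    (hB : (B : E3 →ₗ[ℝ] E3).IsSymmetric) (hB0 : ∀ z, 0 ≤ inner ℝ (B z) z) {ε : ℝ} (hε : 0 < ε)
    (x : S2) :
    ‖grad (regularizedSeminorm B ε) x‖ ≤ ε * √‖B‖ ∧ ∀ v : TangentPlane x, ‖v‖ = 1 →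
      -(ε * √‖B‖) ≤ inner ℝ (hess (regularizedSeminorm B ε) x v) v := by
  have hcd := contDiffAt_inNormalCoords (contMDiff_regularizedSeminorm hB0 hε) x 0
  have hle : ∀ z : E3, ‖z‖ = 1 → inner ℝ (B z) z ≤ ‖B‖ := by
    intro z hz
    calc inner ℝ (B z) z ≤ ‖B z‖ * ‖z‖ := real_inner_le_norm _ _
      _ ≤ ‖B‖ * ‖z‖ * ‖z‖ := by gcongr; exact B.le_opNorm z
      _ = ‖B‖ := by rw [hz]; ring
  have hA0 := hB0 (x : E3)
  have hA1 := hle x (norm_coe_sphere x)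
  have hw0 : 0 < ε ^ 2 + inner ℝ (B x) (x : E3) := by positivity
  obtain ⟨s, hs⟩ : ∃ s, s = √(ε ^ 2 + inner ℝ (B x) (x : E3)) := ⟨_, rfl⟩
  have hs0 : 0 < s := by rw [hs]; exact Real.sqrt_pos.2 hw0
  have hs2 : s ^ 2 = ε ^ 2 + inner ℝ (B x) (x : E3) := by rw [hs, Real.sq_sqrt hw0.le]
  have hAs : inner ℝ (B x) (x : E3) ≤ s ^ 2 := by rw [hs2]; nlinarith
  have hN := Real.sqrt_nonneg ‖B‖
  have hN2 := Real.sq_sqrt (norm_nonneg B)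
  constructor
  · refine norm_le_of_inner_unit (by positivity) fun v hv => ?_
    rw [(hasJetAlong_regularizedSeminorm hB hB0 hε hv hs).inner_grad hcd]
    refine mul_le_mul_of_nonneg_left ?_ hε.le
    rw [div_le_iff₀ hs0]
    refine (abs_le_of_sq_le_sq' ?_ (by positivity)).2
    have hcs := inner_sq_le_of_nonneg hB hB0 (x : E3) (v : E3)
    calc _ ≤ _ := hcs
      _ ≤ s ^ 2 * ‖B‖ := mul_le_mul hAs (hle v hv) (hB0 v) (by positivity)
      _ = _ := by rw [mul_pow, hN2]; ring
  · intro v hv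
    rw [(hasJetAlong_regularizedSeminorm hB hB0 hε hv hs).inner_hess hcd, ← mul_neg]
    refine mul_le_mul_of_nonneg_left ?_ hε.le
    have hcs := inner_sq_le_of_nonneg hB hB0 (x : E3) (v : E3)
    set A := inner ℝ (B x) (x : E3)
    set b := inner ℝ (B x) (v : E3)
    set C := inner ℝ (B v) (v : E3)
    have hC0 : 0 ≤ C := hB0 v
    have h1 : b * (b / s) ≤ C * s := by
      rw [← mul_div_assoc, div_le_iff₀ hs0]
      nlinarith [mul_le_mul_of_nonneg_right hAs hC0]
    have h2 : A ≤ √‖B‖ * s := by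
      refine (abs_le_of_sq_le_sq' ?_ (by positivity)).2
      calc A ^ 2 = A * A := by ring
        _ ≤ ‖B‖ * s ^ 2 := mul_le_mul hA1 hAs hA0 (norm_nonneg _)
        _ = _ := by rw [mul_pow, hN2]
    rw [le_div_iff₀ (by positivity)]
    nlinarith [mul_le_mul_of_nonneg_right h2 hs0.le]

/-! ### Elliptic test functions with a prescribed jet -/

/-- An endomorphism of the tangent plane extended by zero on the normal line. -/
def extendByZero (x : S2) (M : TangentPlane x →L[ℝ] TangentPlane x) : E3 →L[ℝ] E3 :=
  (TangentPlane x).subtypeL ∘L M ∘L (TangentPlane x).orthogonalProjectionOnto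

theorem inner_extendByZero (x : S2) (M : TangentPlane x →L[ℝ] TangentPlane x) (z w : E3) :
    inner ℝ (extendByZero x M z) w = inner ℝ (M ((TangentPlane x).orthogonalProjectionOnto z))
      ((TangentPlane x).orthogonalProjectionOnto w) := by
  have h := Submodule.inner_orthogonalProjectionOnto_eq_of_mem_left (K := TangentPlane x)
    (M ((TangentPlane x).orthogonalProjectionOnto z)) w
  rw [h]
  rfl

theorem inner_extendByZero_coe (x : S2) (M : TangentPlane x →L[ℝ] TangentPlane x)
    (v w : TangentPlane x) : inner ℝ (extendByZero x M v) (w : E3) = inner ℝ (M v) w := by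
  rw [inner_extendByZero]; simp

theorem extendByZero_self (x : S2) (M : TangentPlane x →L[ℝ] TangentPlane x) :
    extendByZero x M x = 0 := by
  have h : (TangentPlane x).orthogonalProjectionOnto (x : E3) = 0 := by
    rw [Submodule.orthogonalProjectionOnto_eq_zero_iff, Submodule.mem_orthogonal]
    exact fun v hv => inner_tangent_sphere x ⟨v, hv⟩
  simp [extendByZero, h]

theorem extendByZero_isSymmetric {x : S2} {M : TangentPlane x →L[ℝ] TangentPlane x}
    (hM : (M : TangentPlane x →ₗ[ℝ] TangentPlane x).IsSymmetric) :
    (extendByZero x M : E3 →ₗ[ℝ] E3).IsSymmetric := by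
  intro z w
  simp only [ContinuousLinearMap.coe_coe]
  rw [real_inner_comm (extendByZero x M w) z, inner_extendByZero, inner_extendByZero,
    real_inner_comm _ (M ((TangentPlane x).orthogonalProjectionOnto w))]
  exact hM _ _

theorem sinc_pos {r : ℝ} (h0 : 0 ≤ r) (hr : r < Real.pi) : 0 < Real.sinc r := by
  have h1 := deriv_costProfile_cos h0 hr
  have h2 := deriv_costProfile_neg (neg_one_lt_cos_norm h0 hr) (Real.cos_le_one r)
  nlinarith

/-- With y = exp(p/κ), the equation equal to 1 says that the contracted cost has gradient p, and the
last bound says that its Hessian plus A is less than δ. All parameters are perturbations of κ = k =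
μ = 1, where the error vanishes by continuity. -/
theorem exists_contraction_parameters {r δ : ℝ} (hr0 : 0 ≤ r) (hr : r < Real.pi) (hδ : 0 < δ) :
    ∃ κ k μ τ : ℝ, 0 < κ ∧ r / κ < Real.pi ∧ 0 < k ∧ k < 1 ∧ 0 ≤ μ ∧ μ ≤ 1 ∧
      τ = 1 - k ^ 2 + k ^ 2 * Real.cos (r / κ) ∧
      -(μ * k ^ 2 * deriv costProfile τ) * (Real.sinc (r / κ) / κ) = 1 ∧
      |-(μ * k ^ 4 * deriv (deriv costProfile) τ) * (Real.sinc (r / κ) / κ) ^ 2 +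
          deriv (deriv costProfile) (Real.cos r) * Real.sinc r ^ 2| * r ^ 2 +
        |μ * k ^ 2 * deriv costProfile τ * Real.cos (r / κ) -
          deriv costProfile (Real.cos r) * Real.cos r| < δ := by
  set S : ℝ × ℝ → ℝ := fun q => r / q.1 with hS
  set τ : ℝ × ℝ → ℝ := fun q => 1 - q.2 ^ 2 + q.2 ^ 2 * Real.cos (S q) with hτ
  set c : ℝ × ℝ → ℝ := fun q => Real.sinc (S q) / q.1 with hc
  -- μ is forced by matching the gradient.
  set μ : ℝ × ℝ → ℝ := fun q => -(1 / (q.2 ^ 2 * deriv costProfile (τ q) * c q)) with hμ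
  set Err : ℝ × ℝ → ℝ := fun q =>
    |-(μ q * q.2 ^ 4 * deriv (deriv costProfile) (τ q)) * c q ^ 2 +
          deriv (deriv costProfile) (Real.cos r) * Real.sinc r ^ 2| * r ^ 2 +
        |μ q * q.2 ^ 2 * deriv costProfile (τ q) * Real.cos (S q) -
          deriv costProfile (Real.cos r) * Real.cos r| with hErr
  have hScont : ∀ q : ℝ × ℝ, 0 < q.1 → ContinuousAt S q := fun q hq =>
    continuousAt_const.div continuousAt_fst hq.ne'
  have hτcont : ∀ q : ℝ × ℝ, 0 < q.1 → ContinuousAt τ q := fun q hq => by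
    have := hScont q hq
    fun_prop
  have hccont : ∀ q : ℝ × ℝ, 0 < q.1 → ContinuousAt c q := fun q hq =>
    (Real.continuous_sinc.continuousAt.comp (hScont q hq)).div continuousAt_fst hq.ne'
  have hτ1 : ∀ κ : ℝ, τ (κ, 1) = Real.cos (r / κ) := fun κ => by simp [hτ, hS]
  have hprod : ∀ κ : ℝ, 0 < κ → r / κ < Real.pi →
      deriv costProfile (τ (κ, 1)) * c (κ, 1) = -(1 / κ) := by
    intro κ hκ hrκ
    rw [hτ1, hc, ← mul_div_assoc, deriv_costProfile_cos (by positivity) hrκ]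
    ring
  have hgcont : ∀ κ : ℝ, 0 < κ → r / κ < Real.pi →
      ContinuousAt (fun q => deriv costProfile (τ q)) (κ, 1) := by
    intro κ hκ hrκ
    refine ContinuousAt.comp (g := deriv costProfile) ?_ (hτcont (κ, 1) hκ)
    rw [hτ1]
    exact (contDiffAt_deriv_costProfile (neg_one_lt_cos_norm (by positivity) hrκ)
      (Real.cos_le_one _)).continuousAt
  -- Without contraction, -μ c(·, exp(p/κ)) has gradient (μ/κ) p, so matching gives μ = κ. Taking κ
  -- < 1 therefore leaves room for μ < 1 once k is moved below 1.
  have hμ1 : ∀ κ : ℝ, 0 < κ → r / κ < Real.pi → μ (κ, 1) = κ := by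
    intro κ hκ hrκ
    rw [hμ]
    simp only [one_pow, one_mul]
    rw [hprod κ hκ hrκ]
    field_simp
  have hμcont : ∀ κ : ℝ, 0 < κ → r / κ < Real.pi → ContinuousAt μ (κ, 1) := by
    intro κ hκ hrκ
    refine (continuousAt_const.div (((continuousAt_snd.pow 2).mul (hgcont κ hκ hrκ)).mul
      (hccont (κ, 1) hκ)) ?_).neg
    change (1 : ℝ) ^ 2 * deriv costProfile (τ (κ, 1)) * c (κ, 1) ≠ 0
    rw [one_pow, one_mul, hprod κ hκ hrκ]
    have : 0 < 1 / κ := by positivity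
    linarith
  have hr1 : r / 1 < Real.pi := by simpa using hr
  have hErrcont : ContinuousAt Err (1, 1) := by
    have h1 := hμcont 1 one_pos hr1
    have h2 := hgcont 1 one_pos hr1
    have h3 : ContinuousAt (fun q => deriv (deriv costProfile) (τ q)) (1, 1) := by
      refine ContinuousAt.comp (g := deriv (deriv costProfile)) ?_ (hτcont (1, 1) one_pos)
      rw [hτ1]
      exact (contDiffAt_deriv_deriv_costProfile (neg_one_lt_cos_norm (by positivity) hr1)
        (Real.cos_le_one _)).continuousAt
    have h4 := hccont (1, 1) one_pos
    have h5 := hScont (1, 1) one_pos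
    have h6 : ContinuousAt (fun q => Real.cos (S q)) (1, 1) :=
      Real.continuous_cos.continuousAt.comp h5
    exact ((((h1.mul (continuousAt_snd.pow 4)).mul h3).neg.mul (h4.pow 2)).add
      continuousAt_const).abs.mul continuousAt_const |>.add
      ((((h1.mul (continuousAt_snd.pow 2)).mul h2).mul h6).sub continuousAt_const).abs
  have hErr1 : Err (1, 1) = 0 := by
    simp only [hErr, hμ1 1 one_pos hr1, hτ1 1, hc, hS]
    simp
  have hev : ∀ᶠ q in 𝓝 ((1 : ℝ), (1 : ℝ)), Err q < δ := by
    refine hErrcont.eventually (gt_mem_nhds ?_)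
    rw [hErr1]; exact hδ
  have hSev : ∀ᶠ κ in 𝓝 (1 : ℝ), r / κ < Real.pi :=
    (continuousAt_const.div continuousAt_id one_ne_zero).eventually (gt_mem_nhds hr1)
  -- The order matters: κ < 1 is fixed first, and k is then taken near 1 depending on κ.
  obtain ⟨κ, ⟨⟨hκ1, hκ2⟩, hκ3⟩, hκ4⟩ := (((hev.curry_nhds.and hSev).and
    (lt_mem_nhds one_pos)).filter_mono nhdsWithin_le_nhds |>.and
    (self_mem_nhdsWithin (s := Set.Iio (1 : ℝ)))).exists
  have hslice : ContinuousAt (fun k : ℝ => μ (κ, k)) 1 :=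
    ContinuousAt.comp (g := μ) (hμcont κ hκ3 hκ2) (by fun_prop)
  have hμev : ∀ᶠ k in 𝓝 (1 : ℝ), μ (κ, k) < 1 := by
    refine hslice.eventually (gt_mem_nhds ?_)
    change μ (κ, 1) < 1
    rw [hμ1 κ hκ3 hκ2]; exact hκ4
  obtain ⟨k, ⟨⟨hk1, hk2⟩, hk3⟩, hk4⟩ := (((hκ1.and hμev).and
    (lt_mem_nhds one_pos)).filter_mono nhdsWithin_le_nhds |>.and
    (self_mem_nhdsWithin (s := Set.Iio (1 : ℝ)))).exists
  have hk4 : k < 1 := hk4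
  have hcpos : 0 < c (κ, k) := div_pos (sinc_pos (by positivity) hκ2) hκ3
  have hmem := contracted_mem hk3 hk4 (Real.abs_cos_le_one (r / κ))
  have hneg : deriv costProfile (τ (κ, k)) < 0 := deriv_costProfile_neg hmem.1 hmem.2
  have hden : k ^ 2 * deriv costProfile (τ (κ, k)) * c (κ, k) < 0 :=
    mul_neg_of_neg_of_pos (mul_neg_of_pos_of_neg (by positivity) hneg) hcpos
  refine ⟨κ, k, μ (κ, k), τ (κ, k), hκ3, hκ2, hk3, hk4, ?_, hk2.le, rfl, ?_, hk1⟩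
  · simp only [hμ]
    rw [neg_nonneg]
    exact (one_div_neg.2 hden).le
  · change -(μ (κ, k) * k ^ 2 * deriv costProfile (τ (κ, k))) * c (κ, k) = 1
    have : μ (κ, k) * (k ^ 2 * deriv costProfile (τ (κ, k)) * c (κ, k)) = -1 := by
      simp only [hμ]
      rw [neg_mul, one_div, inv_mul_cancel₀ hden.ne]
    linarith

/-- The contracted cost has gradient at most kπ < π and margin 1 - k everywhere, so a perturbation
with small gradient and almost nonnegative Hessian preserves ellipticity. Uniform continuity of the
form of A on a compact set of gradients makes ε independent of the point. -/
theorem contracted_add_regularized_mem {k μ : ℝ} (hk0 : 0 < k) (hk1 : k < 1) (hμ0 : 0 ≤ μ)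
    (hμ1 : μ ≤ 1) (y : S2) {B : E3 →L[ℝ] E3} (hB : (B : E3 →ₗ[ℝ] E3).IsSymmetric)
    (hB0 : ∀ z, 0 ≤ inner ℝ (B z) z) :
    ∃ ε > 0, (fun z => contractedCost μ k y z + regularizedSeminorm B ε z) ∈ ellipticF := by
  -- The midpoint of kπ and π leaves room for the perturbed gradient while staying away from the
  -- singularity of A.
  set r' := (k * Real.pi + Real.pi) / 2 with hr'
  have hπ := Real.pi_pos
  have hkπ : k * Real.pi < r' := by rw [hr']; nlinarith
  have hr'π : r' < Real.pi := by rw [hr']; nlinarith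
  have hcomp : IsCompact (Metric.closedBall (0 : E3) r' ×ˢ Metric.closedBall (0 : E3) 1) :=
    (isCompact_closedBall _ _).prod (isCompact_closedBall _ _)
  have hcont : ContinuousOn (fun z : E3 × E3 => costForm z.1 z.2)
      (Metric.closedBall (0 : E3) r' ×ˢ Metric.closedBall (0 : E3) 1) := by
    rintro ⟨p, v⟩ ⟨hp, -⟩
    have : ‖p‖ ≤ r' := by simpa using hp
    exact (continuousAt_costForm (this.trans_lt hr'π)).continuousWithinAt
  obtain ⟨η, hη, hηc⟩ := Metric.uniformContinuousOn_iff.1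
    (hcomp.uniformContinuousOn_of_continuous hcont) ((1 - k) / 2) (by linarith)
  set m := min (min η (r' - k * Real.pi)) ((1 - k) / 2) with hm
  have hm0 : 0 < m := lt_min (lt_min hη (by linarith)) (by linarith)
  have hN := Real.sqrt_nonneg ‖B‖
  set ε := m / 2 / (√‖B‖ + 1) with hε
  have hε0 : 0 < ε := by positivity
  have hεN : ε * √‖B‖ < m := by
    calc ε * √‖B‖ ≤ ε * (√‖B‖ + 1) := by gcongr; linarith
      _ = m / 2 := by rw [hε]; field_simp
      _ < m := by linarith
  have hmη : m ≤ η := (min_le_left _ _).trans (min_le_left _ _)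
  have hmr : m ≤ r' - k * Real.pi := (min_le_left _ _).trans (min_le_right _ _)
  have hmk : m ≤ (1 - k) / 2 := min_le_right _ _
  have hφ0 := contMDiff_contractedCost μ hk0 hk1 y
  have hφ1 := contMDiff_regularizedSeminorm hB0 hε0
  have hφ : ContMDiff (𝓡 2) 𝓘(ℝ, ℝ) ∞
      (fun z => contractedCost μ k y z + regularizedSeminorm B ε z) := hφ0.add hφ1
  refine ⟨ε, hε0, hφ.of_le (by norm_cast), fun x => ?_⟩
  have hc0 := contDiffAt_inNormalCoords hφ0 x 0
  have hc1 := contDiffAt_inNormalCoords hφ1 x 0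
  have hc := contDiffAt_inNormalCoords hφ x 0
  obtain ⟨hgrad0, hhess0⟩ := contractedCost_elliptic hk0 hk1 hμ0 hμ1 x y
  obtain ⟨hgrad1, hhess1⟩ := regularizedSeminorm_bounds hB hB0 hε0 x
  have hj := fun v => (hasJetAlong_self v hc0).add (hasJetAlong_self v hc1)
  have hg : grad (fun z => contractedCost μ k y z + regularizedSeminorm B ε z) x =
      grad (contractedCost μ k y) x + grad (regularizedSeminorm B ε) x := by
    refine ext_inner_right ℝ fun v => ?_
    rw [(hj v).inner_grad hc, inner_add_left]
  have hnorm : ‖grad (fun z => contractedCost μ k y z + regularizedSeminorm B ε z) x‖ ≤ r' := by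
    rw [hg]
    exact (norm_add_le _ _).trans (by linarith)
  have hlt := hnorm.trans_lt hr'π
  refine isPositive_of_unit ((hess_isSymmetric hφ x).add (coeffA_isSymmetric hlt)) fun v hv => ?_
  rw [add_apply, inner_add_left, inner_coeffA hlt hv, (hj v).inner_hess hc]
  have h0 := hhess0 v hv
  have h1 := hhess1 v hv
  have hv' : ‖(v : E3)‖ ≤ 1 := by rw [Submodule.norm_coe, hv]
  have hclose := hηc
    ((grad (fun z => contractedCost μ k y z + regularizedSeminorm B ε z) x : E3), (v : E3))
    ⟨by simpa using hnorm, by simpa using hv'⟩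
    ((grad (contractedCost μ k y) x : E3), (v : E3))
    ⟨by simpa using hgrad0.trans hkπ.le, by simpa using hv'⟩ (by
      rw [Prod.dist_eq, dist_self, dist_eq_norm, ← Submodule.coe_sub, hg, add_sub_cancel_left,
        Submodule.norm_coe, max_eq_left (norm_nonneg _)]
      linarith)
  rw [Real.dist_eq] at hclose
  have := (abs_lt.1 hclose).1
  linarith

/-- Every strictly elliptic jet whose gradient is shorter than `π` is the jet of a smooth function
which is elliptic on the whole sphere. -/
theorem exists_ellipticF_jet {x₀ : S2} {p : TangentPlane x₀} (hp : ‖p‖ < Real.pi)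
    {M : TangentPlane x₀ →L[ℝ] TangentPlane x₀}
    (hM : (M : TangentPlane x₀ →ₗ[ℝ] TangentPlane x₀).IsSymmetric)
    (hpos : ∀ v : TangentPlane x₀, ‖v‖ = 1 → 0 < inner ℝ (M v) v + costForm p v) :
    ∃ φ : S2 → ℝ, ContMDiff (𝓡 2) 𝓘(ℝ, ℝ) ∞ φ ∧ φ ∈ ellipticF ∧ grad φ x₀ = p ∧
      hess φ x₀ = M := by
  -- Compactness of the unit circle turns strict positivity into a uniform margin, which sets the
  -- accuracy required of the parameters.
  obtain ⟨δ, hδ, hδM⟩ : ∃ δ, 0 < δ ∧ ∀ v ∈ Metric.sphere (0 : TangentPlane x₀) 1,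
      δ ≤ inner ℝ (M v) v + costForm p v := by
    refine (isCompact_sphere (0 : TangentPlane x₀) 1).exists_forall_le' ?_ fun v hv =>
      hpos v (by simpa using hv)
    refine ContinuousOn.add (by fun_prop) fun v _ => ContinuousAt.continuousWithinAt ?_
    exact ContinuousAt.comp (g := fun z : E3 × E3 => costForm z.1 z.2)
      (f := fun v : TangentPlane x₀ => ((p : E3), (v : E3))) (continuousAt_costForm hp)
      (by fun_prop)
  obtain ⟨κ, k, μ, τ, hκ, hrκ, hk0, hk1, hμ0, hμ1, hτ, hone, herr⟩ :=
    exists_contraction_parameters (norm_nonneg p) hp hδ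
  set y := expS x₀ (κ⁻¹ • p) with hy
  have hn : ‖κ⁻¹ • p‖ = ‖p‖ / κ := by
    rw [norm_smul, norm_inv, Real.norm_of_nonneg hκ.le, inv_mul_eq_div]
  have hxy : inner ℝ (x₀ : E3) (y : E3) = Real.cos (‖p‖ / κ) := by rw [hy, inner_sphere_expS, hn]
  have hvy : ∀ v : TangentPlane x₀,
      inner ℝ (v : E3) (y : E3) = Real.sinc (‖p‖ / κ) / κ * inner ℝ p v := by
    intro v
    rw [hy, inner_tangent_expS, hn, Submodule.coe_smul, real_inner_smul_left, ← Submodule.coe_inner]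
    ring
  have hφ0 := contMDiff_contractedCost μ hk0 hk1 y
  have hc0 := contDiffAt_inNormalCoords hφ0 x₀ 0
  have hg0 : grad (contractedCost μ k y) x₀ = p := by
    refine ext_inner_unit fun v hv => ?_
    rw [(hasJetAlong_contractedCost μ hk0 hk1 y hv hxy hτ).inner_grad hc0, hvy, ← mul_assoc, hone,
      one_mul]
  -- Q is the Hessian still missing. It is nonnegative because M + A ≥ δ, while the contracted cost
  -- has Hessian plus A below δ.
  set Q := M - hess (contractedCost μ k y) x₀ with hQ
  have hQs : (Q : TangentPlane x₀ →ₗ[ℝ] TangentPlane x₀).IsSymmetric :=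
    hM.sub (hess_isSymmetric hφ0 x₀)
  have hQpos : Q.IsPositive := by
    refine isPositive_of_unit hQs fun v hv => ?_
    have h1 := hδM v (by simpa using hv)
    rw [hQ, sub_apply, inner_sub_left,
      (hasJetAlong_contractedCost μ hk0 hk1 y hv hxy hτ).inner_hess hc0, hvy]
    rw [costForm, ← Submodule.coe_inner, Submodule.norm_coe] at h1
    have h2 : inner ℝ p v ^ 2 ≤ ‖p‖ ^ 2 := by
      have := abs_real_inner_le_norm p v
      rw [hv, mul_one] at this
      rw [← sq_abs]; gcongr
    set α := -(μ * k ^ 4 * deriv (deriv costProfile) τ) * (Real.sinc (‖p‖ / κ) / κ) ^ 2 with hα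
    set α₀ := deriv (deriv costProfile) (Real.cos ‖p‖) * Real.sinc ‖p‖ ^ 2 with hα₀
    have h3 : (α + α₀) * inner ℝ p v ^ 2 ≤ |α + α₀| * ‖p‖ ^ 2 :=
      mul_le_mul (le_abs_self _) h2 (sq_nonneg _) (abs_nonneg _)
    have h4 := le_abs_self (μ * k ^ 2 * deriv costProfile τ * Real.cos (‖p‖ / κ) -
          deriv costProfile (Real.cos ‖p‖) * Real.cos ‖p‖)
    have e1 : -(μ * k ^ 4 * deriv (deriv costProfile) τ) *
        (Real.sinc (‖p‖ / κ) / κ * inner ℝ p v) ^ 2 = α * inner ℝ p v ^ 2 := by rw [hα]; ring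
    have e2 : deriv (deriv costProfile) (Real.cos ‖p‖) * (Real.sinc ‖p‖ * inner ℝ p v) ^ 2 =
        α₀ * inner ℝ p v ^ 2 := by rw [hα₀]; ring
    rw [e1]
    rw [e2] at h1
    linarith
  have hB := extendByZero_isSymmetric hQs
  have hB0 : ∀ z, 0 ≤ inner ℝ (extendByZero x₀ Q z) z := fun z => by
    rw [inner_extendByZero]; exact hQpos.2 _
  obtain ⟨ε, hε, hmem⟩ := contracted_add_regularized_mem hk0 hk1 hμ0 hμ1 y hB hB0
  have hφ1 := contMDiff_regularizedSeminorm hB0 hε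
  have hφ : ContMDiff (𝓡 2) 𝓘(ℝ, ℝ) ∞
      (fun z => contractedCost μ k y z + regularizedSeminorm (extendByZero x₀ Q) ε z) := hφ0.add hφ1
  have hc := contDiffAt_inNormalCoords hφ x₀ 0
  have hj : ∀ v : TangentPlane x₀, ‖v‖ = 1 → HasJetAlong
      (fun z => contractedCost μ k y z + regularizedSeminorm (extendByZero x₀ Q) ε z) x₀ v
      (inner ℝ p v) (inner ℝ (M v) v) := by
    intro v hv
    have h1 := hasJetAlong_self v hc0
    -- Since the extension of Q kills x₀, the square root equals ε there; the added term has zero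
    -- gradient and Hessian exactly Q, whatever ε is.
    have hs : ε = √(ε ^ 2 + inner ℝ (extendByZero x₀ Q x₀) (x₀ : E3)) := by
      rw [extendByZero_self, inner_zero_left, add_zero, Real.sqrt_sq hε.le]
    have h2 := hasJetAlong_regularizedSeminorm hB hB0 hε hv hs
    rw [extendByZero_self, inner_zero_left, inner_zero_left, inner_extendByZero_coe] at h2
    convert h1.add h2 using 1
    · rw [hg0]; ring
    · rw [hQ, sub_apply, inner_sub_left]; field_simp; ring
  refine ⟨_, hφ, hmem, ext_inner_unit fun v hv => (hj v hv).inner_grad hc, ?_⟩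
  exact eq_of_inner_unit (hess_isSymmetric hφ x₀) hM fun v hv => (hj v hv).inner_hess hc

/-! ### The logarithm of the sphere -/

/-- The inverse of the exponential map at `x`, away from the antipode of `x`. -/
def logS (x y : S2) : TangentPlane x :=
  -deriv costProfile (inner ℝ (x : E3) (y : E3)) • tangentPart x y

theorem norm_logS {x y : S2} (h : -1 < inner ℝ (x : E3) (y : E3)) :
    ‖logS x y‖ = Real.arccos (inner ℝ (x : E3) (y : E3)) := by
  have h2 := (abs_le.1 (abs_inner_sphere_le x y)).2
  rw [← sq_eq_sq₀ (norm_nonneg _) (Real.arccos_nonneg _), logS, norm_smul, mul_pow, norm_neg,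
    Real.norm_eq_abs, sq_abs, norm_tangentPart_sq, deriv_costProfile_sq h h2, costProfile, if_pos h2]
  ring

theorem arccos_lt_pi {a : ℝ} (h : -1 < a) (h' : a ≤ 1) : Real.arccos a < Real.pi := by
  have := Real.arccos_lt_arccos le_rfl h h'
  rwa [Real.arccos_neg_one] at this

theorem norm_logS_lt {x y : S2} (h : -1 < inner ℝ (x : E3) (y : E3)) : ‖logS x y‖ < Real.pi := by
  rw [norm_logS h]; exact arccos_lt_pi h (abs_le.1 (abs_inner_sphere_le x y)).2

theorem expS_logS {x y : S2} (h : -1 < inner ℝ (x : E3) (y : E3)) : expS x (logS x y) = y := by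
  have h2 := (abs_le.1 (abs_inner_sphere_le x y)).2
  have hc := Real.cos_arccos h.le h2
  have hs := deriv_costProfile_cos (Real.arccos_nonneg _) (arccos_lt_pi h h2)
  rw [hc] at hs
  ext1
  rw [coe_expS, norm_logS h, hc, logS, Submodule.coe_smul, smul_smul, tangentPart]
  rw [show Real.sinc (Real.arccos (inner ℝ (x : E3) (y : E3))) *
    -deriv costProfile (inner ℝ (x : E3) (y : E3)) = 1 by linarith, one_smul,
    add_sub_cancel]

/-- The logarithm at x is a right inverse of the exponential map near x and tends to 0 there, so
neighbourhoods of 0 in normal coordinates control neighbourhoods of x. -/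
theorem eventually_nhds_of_normalCoords {x : S2} {P : S2 → Prop}
    (h : ∀ᶠ v in 𝓝 (0 : TangentPlane x), P (expS x v)) : ∀ᶠ z in 𝓝 x, P z := by
  have hc : Continuous (fun z : S2 => inner ℝ (x : E3) (z : E3)) := by fun_prop
  have hgt : ∀ᶠ z : S2 in 𝓝 x, -1 < inner ℝ (x : E3) (z : E3) :=
    hc.continuousAt.eventually (lt_mem_nhds (by simp only [inner_self_sphere]; norm_num))
  have hlog : Filter.Tendsto (logS x) (𝓝 x) (𝓝 0) := by
    rw [tendsto_zero_iff_norm_tendsto_zero]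
    have h1 := (Real.continuous_arccos.comp hc).tendsto x
    simp only [Function.comp_apply, inner_self_sphere, Real.arccos_one] at h1
    refine h1.congr' ?_
    filter_upwards [hgt] with z hz using (norm_logS hz).symm
  filter_upwards [hlog.eventually h, hgt] with z hz hz'
  rwa [expS_logS hz'] at hz

theorem tendsto_expS_smul (x : S2) (v : TangentPlane x) :
    Filter.Tendsto (fun t : ℝ => expS x (t • v)) (𝓝 0) (𝓝 x) := by
  have h1 : Continuous (expS x) := (contMDiff_expS x).continuous
  have h2 := h1.continuousAt.tendsto.comp (tendsto_smul_zero v)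
  rwa [expS_zero] at h2

/-! ### Local extrema and jets -/

/-- The gradient at v is δv + o(|v|), so its radial component is nonnegative near 0 and f is
nondecreasing along short rays. -/
theorem isLocalMin_of_gradient {E : Type*} [NormedAddCommGroup E] [InnerProductSpace ℝ E]
    [CompleteSpace E] {f : E → ℝ} (hf : Differentiable ℝ f) (h0 : gradient f 0 = 0) {δ : ℝ}
    (hδ : 0 < δ) (h : HasFDerivAt (gradient f) (δ • ContinuousLinearMap.id ℝ E) 0) :
    IsLocalMin f 0 := by
  have ho := (hasFDerivAt_iff_isLittleO_nhds_zero.1 h).bound hδ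
  simp only [zero_add, h0, sub_zero, smul_apply, ContinuousLinearMap.id_apply] at ho
  obtain ⟨ρ, hρ, hball⟩ := Metric.eventually_nhds_iff_ball.1 ho
  have hnn : ∀ v ∈ Metric.ball (0 : E) ρ, 0 ≤ inner ℝ (gradient f v) v := by
    intro v hv
    have h1 := hball v hv
    have h2 := abs_real_inner_le_norm (gradient f v - δ • v) v
    rw [inner_sub_left, real_inner_smul_left, real_inner_self_eq_norm_sq] at h2
    have h3 := (abs_le.1 h2).1
    nlinarith [mul_le_mul_of_nonneg_right h1 (norm_nonneg v)]
  filter_upwards [Metric.ball_mem_nhds (0 : E) hρ] with v hv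
  have hd : ∀ t : ℝ, HasDerivAt (fun t : ℝ => f (t • v)) (inner ℝ (gradient f (t • v)) v) t := by
    intro t
    have h1 := (hf (t • v)).hasGradientAt.hasFDerivAt.comp_hasDerivAt t
      ((hasDerivAt_id t).smul_const v)
    exact h1.congr_deriv (by simp)
  have hmono : MonotoneOn (fun t : ℝ => f (t • v)) (Set.Icc 0 1) := by
    refine monotoneOn_of_deriv_nonneg (convex_Icc 0 1)
      (fun t _ => (hd t).continuousAt.continuousWithinAt)
      (fun t _ => (hd t).differentiableAt.differentiableWithinAt) fun t ht => ?_
    rw [interior_Icc] at ht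
    rw [(hd t).deriv]
    have hv' : ‖v‖ < ρ := by simpa using hv
    have h1 := hnn (t • v) (by
      rw [mem_ball_zero_iff, norm_smul, Real.norm_of_nonneg ht.1.le]
      nlinarith [norm_nonneg v, ht.1, ht.2])
    rw [real_inner_smul_right] at h1
    exact (mul_nonneg_iff_of_pos_left ht.1).1 h1
  have := hmono (Set.left_mem_Icc.2 zero_le_one) (Set.right_mem_Icc.2 zero_le_one) zero_le_one
  simpa using this

theorem HasJetAlong.sub {u w : S2 → ℝ} {x : S2} {v : TangentPlane x} {a₁ a₂ b₁ b₂ : ℝ}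
    (hu : HasJetAlong u x v a₁ a₂) (hw : HasJetAlong w x v b₁ b₂) :
    HasJetAlong (fun z => u z - w z) x v (a₁ - b₁) (a₂ - b₂) := by
  obtain ⟨D, h1, rfl, h3⟩ := hu
  obtain ⟨E, k1, rfl, k3⟩ := hw
  refine ⟨fun t => D t - E t, ?_, rfl, h3.sub k3⟩
  filter_upwards [h1, k1] with t ht kt using ht.sub kt

/-- The strict gap δ is what turns a comparison of jets at one point into a comparison of functions
nearby; equal jets would not suffice. -/
theorem isLocalMin_sub_of_jets {φ ψ : S2 → ℝ} (hφ : ContMDiff (𝓡 2) 𝓘(ℝ, ℝ) ∞ φ)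
    (hψ : ContMDiff (𝓡 2) 𝓘(ℝ, ℝ) ∞ ψ) {x : S2} (hg : grad φ x = grad ψ x) {δ : ℝ} (hδ : 0 < δ)
    (hh : hess φ x = hess ψ x + δ • ContinuousLinearMap.id ℝ (TangentPlane x)) :
    IsLocalMin (fun z => φ z - ψ z) x := by
  have hw : ContMDiff (𝓡 2) 𝓘(ℝ, ℝ) ∞ (fun z => φ z - ψ z) := hφ.sub hψ
  have hc := contDiffAt_inNormalCoords hw x 0
  have hj := fun v => (hasJetAlong_self v (contDiffAt_inNormalCoords hφ x 0)).sub
    (hasJetAlong_self v (contDiffAt_inNormalCoords hψ x 0))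
  have hgrad : grad (fun z => φ z - ψ z) x = 0 := by
    refine ext_inner_unit fun v _ => ?_
    rw [(hj v).inner_grad hc, hg, sub_self, inner_zero_left]
  have hhess : hess (fun z => φ z - ψ z) x = δ • ContinuousLinearMap.id ℝ (TangentPlane x) := by
    refine eq_of_inner_unit (hess_isSymmetric hw x) ?_ fun v _ => ?_
    · intro v w
      simp [real_inner_smul_left, real_inner_smul_right]
    · rw [(hj v).inner_hess hc, hh, add_apply, inner_add_left, add_sub_cancel_left]
  have hmin : IsLocalMin (inNormalCoords (fun z => φ z - ψ z) x) 0 := by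
    refine isLocalMin_of_gradient
      ((hw.comp (contMDiff_expS x)).contDiff.differentiable (by simp)) hgrad hδ ?_
    rw [← hhess]
    exact (gradient_differentiableAt hc).hasFDerivAt
  refine eventually_nhds_of_normalCoords ?_
  filter_upwards [hmin] with v hv
  simpa [inNormalCoords, expS_zero] using hv

theorem HasJetAlong.of_isLocalMin {w : S2 → ℝ} {x : S2} {v : TangentPlane x} {d₁ d₂ : ℝ}
    (h : HasJetAlong w x v d₁ d₂) (hmin : IsLocalMin w x) : d₁ = 0 ∧ 0 ≤ d₂ := by
  obtain ⟨D, h1, rfl, h3⟩ := h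
  have hg : IsLocalMin (fun t : ℝ => w (expS x (t • v))) 0 := by
    have := (tendsto_expS_smul x v).eventually hmin
    filter_upwards [this] with t ht
    simpa [expS_zero] using ht
  have hD0 : D 0 = 0 := hg.hasDerivAt_eq_zero h1.self_of_nhds
  refine ⟨hD0, ?_⟩
  by_contra hneg
  push Not at hneg
  have hderiv : deriv (fun t : ℝ => w (expS x (t • v))) =ᶠ[𝓝 0] D := by
    filter_upwards [h1] with t ht using ht.deriv
  -- A negative second derivative would make 0 also a local maximum, hence the function locally
  -- constant and its second derivative zero.
  have hmax : IsLocalMax (fun t : ℝ => w (expS x (t • v))) 0 := by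
    refine isLocalMax_of_deriv_deriv_neg ?_ ?_ h1.self_of_nhds.continuousAt
    · rw [hderiv.deriv_eq, h3.deriv]; exact hneg
    · rw [hderiv.self_of_nhds, hD0]
  have hconst : ∀ᶠ t in 𝓝 (0 : ℝ), (fun t : ℝ => w (expS x (t • v))) t = w (expS x ((0 : ℝ) • v)) := by
    filter_upwards [hmax, hg] with t ht ht' using le_antisymm ht ht'
  have hD : D =ᶠ[𝓝 0] fun _ => 0 := by
    filter_upwards [h1, hconst.eventually_nhds] with t ht ht'
    exact ht.unique ((hasDerivAt_const t _).congr_of_eventuallyEq ht')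
  have := h3.unique ((hasDerivAt_const 0 (0 : ℝ)).congr_of_eventuallyEq hD)
  linarith

theorem le_of_hasDerivAt_of_eventually_le {f g : ℝ → ℝ} {a b : ℝ} (hf : HasDerivAt f a 0)
    (hg : HasDerivAt g b 0) (h : ∀ᶠ t in 𝓝[>] (0 : ℝ), f t - f 0 ≤ g t - g 0) : a ≤ b := by
  refine le_of_tendsto_of_tendsto hf.tendsto_slope_zero_right hg.tendsto_slope_zero_right ?_
  filter_upwards [h, self_mem_nhdsWithin] with t ht ht0
  have ht0 : 0 < t := ht0
  simp only [zero_add, smul_eq_mul]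
  gcongr

theorem exists_unit_orthogonal {x : S2} (p : TangentPlane x) :
    ∃ v : TangentPlane x, ‖v‖ = 1 ∧ inner ℝ p v = 0 := by
  have hx : (x : E3) ≠ 0 := by
    intro h; have := norm_coe_sphere x; rw [h, norm_zero] at this; norm_num at this
  have hfin : Module.finrank ℝ (TangentPlane x) = 2 := Submodule.finrank_orthogonal_span_singleton hx
  have hlt : Module.finrank ℝ (ℝ ∙ p) < Module.finrank ℝ (TangentPlane x) := by
    rw [hfin]; exact (finrank_span_le_card (R := ℝ) ({p} : Set (TangentPlane x))).trans_lt (by simp)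
  have hne : (ℝ ∙ p)ᗮ ≠ ⊥ := by
    intro h
    rw [Submodule.orthogonal_eq_bot_iff] at h
    rw [h, finrank_top] at hlt
    exact lt_irrefl _ hlt
  obtain ⟨w, hw, hw0⟩ := Submodule.exists_mem_ne_zero_of_ne_bot hne
  refine ⟨‖w‖⁻¹ • w, (eq_norm_smul_unit hw0).1, ?_⟩
  rw [real_inner_smul_right, Submodule.mem_orthogonal_singleton_iff_inner_right.1 hw, mul_zero]

/-! ### `c`-convex functions -/

theorem geoDist_eq_angle (x y : S2) :
    geoDist x y = InnerProductGeometry.angle (x : E3) (y : E3) := by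
  rw [geoDist_eq_arccos, InnerProductGeometry.angle, norm_coe_sphere, norm_coe_sphere, mul_one,
    div_one]

theorem cost_sub_cost_le (x z y : S2) : cost x y - cost z y ≤ Real.pi * geoDist x z := by
  have h1 : geoDist x y ≤ geoDist x z + geoDist z y := by
    simp only [geoDist_eq_angle]; exact InnerProductGeometry.angle_le_angle_add_angle _ _ _
  have h0 : ∀ a b : S2, 0 ≤ geoDist a b := fun a b => by
    rw [geoDist_eq_angle]; exact InnerProductGeometry.angle_nonneg _ _
  have hπ : ∀ a b : S2, geoDist a b ≤ Real.pi := fun a b => by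
    rw [geoDist_eq_angle]; exact InnerProductGeometry.angle_le_pi _ _
  have a1 := h0 x y
  have a2 := h0 z y
  have a3 := h0 x z
  have b1 := hπ x y
  have b2 := hπ z y
  have e : cost x y - cost z y = (geoDist x y - geoDist z y) * ((geoDist x y + geoDist z y) / 2) := by
    rw [cost, cost]; ring
  rw [e]
  calc (geoDist x y - geoDist z y) * ((geoDist x y + geoDist z y) / 2)
      ≤ geoDist x z * ((geoDist x y + geoDist z y) / 2) := by gcongr; linarith
    _ ≤ geoDist x z * Real.pi := by gcongr; linarith
    _ = _ := mul_comm _ _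

theorem IsCConvex.sub_le {u : S2 → ℝ} (hu : IsCConvex u) (x z : S2) :
    u z - u x ≤ Real.pi * geoDist x z := by
  obtain ⟨ψ, hψ⟩ := hu
  have h : u z ≤ u x + Real.pi * geoDist x z := by
    refine (hψ z).2 ?_
    rintro _ ⟨y, rfl⟩
    have h1 : -cost x y - ψ y ≤ u x := (hψ x).1 ⟨y, rfl⟩
    have h2 := cost_sub_cost_le x z y
    dsimp only
    linarith
  linarith

theorem continuous_cost_right (x : S2) : Continuous (cost x) := by
  have : cost x = fun y : S2 => Real.arccos (inner ℝ (x : E3) (y : E3)) ^ 2 / 2 := by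
    funext y; rw [cost, geoDist_eq_arccos]
  rw [this]
  have h1 : Continuous (fun y : S2 => inner ℝ (x : E3) (y : E3)) := by fun_prop
  exact ((Real.continuous_arccos.comp h1).pow 2).div_const 2

/-- The supremum need not be attained, since ψ is arbitrary. A limit point of almost maximizing y
still satisfies the inequality, from which ψ has cancelled and in which the cost is continuous. -/
theorem IsCConvex.exists_subgradient {u : S2 → ℝ} (hu : IsCConvex u) (x : S2) :
    ∃ y, ∀ z, cost x y - cost z y ≤ u z - u x := by
  obtain ⟨ψ, hψ⟩ := hu
  have hne : ∀ n : ℕ, ∃ y, u x - 1 / ((n : ℝ) + 1) < -cost x y - ψ y := by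
    intro n
    have hpos : (0 : ℝ) < 1 / ((n : ℝ) + 1) := by positivity
    obtain ⟨_, ⟨y, rfl⟩, hy, -⟩ := (hψ x).exists_between (sub_lt_self (u x) hpos)
    exact ⟨y, hy⟩
  choose y hy using hne
  obtain ⟨y₀, -, σ, hσ, hlim⟩ := isCompact_univ.tendsto_subseq (fun n => Set.mem_univ (y n))
  refine ⟨y₀, fun z => ?_⟩
  have hl : Filter.Tendsto (fun n => cost x (y (σ n)) - cost z (y (σ n)) - 1 / ((σ n : ℝ) + 1))
      Filter.atTop (𝓝 (cost x y₀ - cost z y₀ - 0)) := by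
    refine Filter.Tendsto.sub (Filter.Tendsto.sub ?_ ?_) ?_
    · exact ((continuous_cost_right x).tendsto y₀).comp hlim
    · exact ((continuous_cost_right z).tendsto y₀).comp hlim
    · exact tendsto_one_div_add_atTop_nhds_zero_nat.comp hσ.tendsto_atTop
  rw [sub_zero] at hl
  refine le_of_tendsto hl (Filter.Eventually.of_forall fun n => ?_)
  have h1 := hy (σ n)
  have h2 : -cost z (y (σ n)) - ψ (y (σ n)) ≤ u z := (hψ z).1 ⟨_, rfl⟩
  linarith

theorem geoDist_expS_smul (x : S2) {v : TangentPlane x} (hv : ‖v‖ = 1) {t : ℝ} (h0 : 0 ≤ t)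
    (hπ : t ≤ Real.pi) : geoDist x (expS x (t • v)) = t := by
  rw [geoDist_eq_arccos, inner_sphere_expS, norm_smul, hv, mul_one, Real.norm_of_nonneg h0,
    Real.arccos_cos h0 hπ]

theorem hasDerivAt_expS_zero {φ : S2 → ℝ} (hφ : ContMDiff (𝓡 2) 𝓘(ℝ, ℝ) ∞ φ) (x : S2)
    (v : TangentPlane x) :
    HasDerivAt (fun t : ℝ => φ (expS x (t • v))) (inner ℝ (grad φ x) v) 0 := by
  have := hasDerivAt_inner_smul (t := 0) (v := v) (u := φ) (x := x)
    ((contDiffAt_inNormalCoords hφ x _).differentiableAt (by simp))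
  rwa [zero_smul] at this

/-- A function touching u from below grows no faster than u, which is π-Lipschitz because each
-c(·,y) is. -/
theorem IsCConvex.norm_grad_le {u φ : S2 → ℝ} (hu : IsCConvex u)
    (hφ : ContMDiff (𝓡 2) 𝓘(ℝ, ℝ) ∞ φ) {x : S2} (h : IsLocalMin (fun z => u z - φ z) x) :
    ‖grad φ x‖ ≤ Real.pi := by
  refine norm_le_of_inner_unit Real.pi_pos.le fun v hv => ?_
  refine le_of_hasDerivAt_of_eventually_le (hasDerivAt_expS_zero hφ x v)
    (g := fun t => Real.pi * t) (by simpa using (hasDerivAt_id (0 : ℝ)).const_mul Real.pi) ?_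
  have h1 := ((tendsto_expS_smul x v).eventually h).filter_mono
    (nhdsWithin_le_nhds (s := Set.Ioi 0))
  filter_upwards [h1, Ioo_mem_nhdsGT Real.pi_pos] with t ht ht'
  have h2 := hu.sub_le x (expS x (t • v))
  rw [geoDist_expS_smul x hv ht'.1.le ht'.2.le] at h2
  rw [zero_smul, expS_zero]
  linarith

theorem IsCConvex.elliptic_of_isLocalMax {u φ : S2 → ℝ} (hu : IsCConvex u)
    (hφ : ContMDiff (𝓡 2) 𝓘(ℝ, ℝ) ∞ φ) {x : S2} (h : IsLocalMax (fun z => u z - φ z) x) :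
    ‖grad φ x‖ < Real.pi ∧ ∀ v : TangentPlane x, ‖v‖ = 1 →
      0 ≤ inner ℝ (hess φ x v) v + costForm (grad φ x) v := by
  obtain ⟨y, hy⟩ := hu.exists_subgradient x
  have hcφ := contDiffAt_inNormalCoords hφ x 0
  have hmin : IsLocalMin (fun z => φ z + cost z y) x := by
    filter_upwards [h] with z hz
    have := hy z
    linarith
  rcases (abs_le.1 (abs_inner_sphere_le x y)).1.lt_or_eq with hxy | hxy
  · have hcc := contDiffAt_cost_inNormalCoords hxy
    have hg : grad φ x = logS x y := by
      refine ext_inner_unit fun v hv => ?_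
      have := (((hasJetAlong_self v hcφ).add (hasJetAlong_cost hxy hv)).of_isLocalMin hmin).1
      rw [logS, real_inner_smul_left, inner_tangentPart]
      linarith
    have hlt : ‖grad φ x‖ < Real.pi := by rw [hg]; exact norm_logS_lt hxy
    refine ⟨hlt, fun v hv => ?_⟩
    have := (((hasJetAlong_self v hcφ).add (hasJetAlong_self v hcc)).of_isLocalMin hmin).2
    rw [← inner_coeffA hlt hv, coeffA, transport, hg, expS_logS hxy]
    exact this
  -- For y antipodal to x the cost falls with slope π in every direction, so φ would have to rise
  -- with slope at least π along both v and -v.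
  · exfalso
    have hcost : ∀ v : TangentPlane x, ‖v‖ = 1 → ∀ t ∈ Set.Ioo 0 Real.pi,
        cost (expS x (t • v)) y = (Real.pi - t) ^ 2 / 2 := by
      intro v hv t ht
      have hvy : inner ℝ (v : E3) (y : E3) = 0 := by
        have := inner_tangent_sq_le x y hv
        rw [← hxy] at this
        exact pow_eq_zero_iff two_ne_zero |>.1 (le_antisymm (by linarith) (sq_nonneg _))
      rw [cost, geoDist_eq_arccos, inner_expS_smul x hv, ← hxy, hvy, mul_zero, add_zero,
        mul_neg_one, Real.arccos_neg, Real.arccos_cos ht.1.le ht.2.le]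
    have hx : cost x y = Real.pi ^ 2 / 2 := by
      rw [cost, geoDist_eq_arccos, ← hxy, Real.arccos_neg_one]
    have key : ∀ v : TangentPlane x, ‖v‖ = 1 → Real.pi ≤ inner ℝ (grad φ x) v := by
      intro v hv
      have hd : HasDerivAt (fun t : ℝ => -((Real.pi - t) ^ 2 / 2)) Real.pi 0 := by
        have := ((((hasDerivAt_id (0 : ℝ)).const_sub Real.pi).pow 2).div_const 2).neg
        refine this.congr_deriv ?_
        simp
        ring
      refine le_of_hasDerivAt_of_eventually_le hd (hasDerivAt_expS_zero hφ x v) ?_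
      have h1 := ((tendsto_expS_smul x v).eventually hmin).filter_mono
        (nhdsWithin_le_nhds (s := Set.Ioi 0))
      filter_upwards [h1, Ioo_mem_nhdsGT Real.pi_pos] with t ht ht'
      rw [hcost v hv t ht', hx] at ht
      rw [zero_smul, expS_zero, sub_zero]
      linarith
    obtain ⟨v, hv, -⟩ := exists_unit_orthogonal (0 : TangentPlane x)
    have h1 := key v hv
    have h2 := key (-v) (by rw [norm_neg, hv])
    rw [inner_neg_right] at h2
    linarith [Real.pi_pos]

/-! ### The space of jets -/

theorem continuous_toAmbient : Continuous Jet.toAmbient := continuous_induced_dom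

theorem tendsto_jet {x : S2} {ι : Type*} {l : Filter ι} {p : ι → TangentPlane x}
    {M : ι → TangentPlane x →L[ℝ] TangentPlane x}
    {hM : ∀ i, (M i : TangentPlane x →ₗ[ℝ] TangentPlane x).IsSymmetric} {p₀ : TangentPlane x}
    {M₀ : TangentPlane x →L[ℝ] TangentPlane x}
    {hM₀ : (M₀ : TangentPlane x →ₗ[ℝ] TangentPlane x).IsSymmetric}
    (hp : Filter.Tendsto p l (𝓝 p₀)) (hMt : Filter.Tendsto M l (𝓝 M₀)) :
    Filter.Tendsto (fun i => Jet.mk x (p i) (M i) (hM i)) l (𝓝 (Jet.mk x p₀ M₀ hM₀)) := by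
  rw [nhds_induced, Filter.tendsto_comap_iff]
  have h1 : Filter.Tendsto (fun i => (p i : E3)) l (𝓝 (p₀ : E3)) :=
    (continuous_subtype_val.tendsto p₀).comp hp
  have h2 : Continuous (fun M : TangentPlane x →L[ℝ] TangentPlane x =>
      (TangentPlane x).subtypeL ∘L M ∘L (TangentPlane x).orthogonalProjectionOnto) :=
    continuous_const.clm_comp (continuous_id.clm_comp continuous_const)
  exact tendsto_const_nhds.prodMk_nhds (h1.prodMk_nhds ((h2.tendsto M₀).comp hMt))

/-- The jet `j` with `δ` times the identity added to the second order part. -/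
def Jet.shift (j : Jet) (δ : ℝ) : Jet :=
  ⟨j.x, j.p, j.M + δ • ContinuousLinearMap.id ℝ (TangentPlane j.x), by
    refine j.symm.add fun v w => ?_
    simp [real_inner_smul_left, real_inner_smul_right]⟩

theorem tendsto_add_smul_zero {E : Type*} [NormedAddCommGroup E] [NormedSpace ℝ E] (a b : E) :
    Filter.Tendsto (fun t : ℝ => a + t • b) (𝓝 0) (𝓝 a) := by
  simpa using (tendsto_smul_zero b).const_add a

theorem Jet.tendsto_shift (j : Jet) : Filter.Tendsto j.shift (𝓝 0) (𝓝 j) := by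
  refine tendsto_jet (hM₀ := j.symm) tendsto_const_nhds ?_
  exact tendsto_add_smul_zero j.M (ContinuousLinearMap.id ℝ (TangentPlane j.x))

theorem Jet.inner_shift (j : Jet) (δ : ℝ) {v : TangentPlane j.x} (hv : ‖v‖ = 1) :
    inner ℝ ((j.shift δ).M v) v = inner ℝ (j.M v) v + δ := by
  change inner ℝ ((j.M + δ • ContinuousLinearMap.id ℝ (TangentPlane j.x)) v) v = _
  rw [add_apply, inner_add_left, smul_apply, ContinuousLinearMap.id_apply, real_inner_smul_left,
    real_inner_self_eq_norm_sq, hv]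
  ring

/-- The gradient is shorter than `π` and the equation is strictly elliptic. -/
def Jet.IsStrictlyElliptic (j : Jet) : Prop :=
  ‖j.p‖ < Real.pi ∧ ∀ v : TangentPlane j.x, ‖v‖ = 1 → 0 < inner ℝ (j.M v) v + costForm j.p v

/-- The tangent plane varies with the jet, so the condition is moved to the ambient unit sphere.
Compactness applies there: vectors not orthogonal to the base point stay nonorthogonal for nearby
base points. -/
theorem Jet.IsStrictlyElliptic.eventually {j₀ : Jet} (h : j₀.IsStrictlyElliptic) :
    ∀ᶠ j in 𝓝 j₀, j.IsStrictlyElliptic := by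
  let q : (E3 × E3 × (E3 →L[ℝ] E3)) × E3 → ℝ := fun z =>
    inner ℝ (z.1.2.2 z.2) z.2 + costForm z.1.2.1 z.2
  have hq : ∀ z : (E3 × E3 × (E3 →L[ℝ] E3)) × E3, ‖z.1.2.1‖ < Real.pi → ContinuousAt q z := by
    intro z hz
    refine ContinuousAt.add (by fun_prop) ?_
    exact ContinuousAt.comp (g := fun w : E3 × E3 => costForm w.1 w.2)
      (f := fun z : (E3 × E3 × (E3 →L[ℝ] E3)) × E3 => (z.1.2.1, z.2))
      (continuousAt_costForm hz) (by fun_prop)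
  have hp : ‖j₀.toAmbient.2.1‖ < Real.pi := h.1
  have hval : ∀ (j : Jet) (v : TangentPlane j.x),
      q (j.toAmbient, (v : E3)) = inner ℝ (j.M v) v + costForm j.p v := by
    intro j v
    rw [← inner_extendByZero_coe j.x j.M]
    rfl
  have key : ∀ᶠ a in 𝓝 j₀.toAmbient, ∀ v ∈ Metric.sphere (0 : E3) 1,
      inner ℝ a.1 v = 0 → 0 < q (a, v) := by
    refine (isCompact_sphere (0 : E3) 1).eventually_forall_of_forall_eventually fun v hv => ?_
    by_cases hxv : inner ℝ j₀.toAmbient.1 v = 0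
    · have hmem : v ∈ TangentPlane j₀.x := Submodule.mem_orthogonal_singleton_iff_inner_right.2 hxv
      have hv1 : ‖(⟨v, hmem⟩ : TangentPlane j₀.x)‖ = 1 := by simpa using hv
      have hpos : 0 < q (j₀.toAmbient, v) := by
        have := hval j₀ ⟨v, hmem⟩
        rw [this]
        exact h.2 _ hv1
      filter_upwards [(hq (j₀.toAmbient, v) hp).eventually (lt_mem_nhds hpos)] with z hz _ using hz
    · have hc : Continuous (fun z : (E3 × E3 × (E3 →L[ℝ] E3)) × E3 => inner ℝ z.1.1 z.2) := by
        fun_prop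
      filter_upwards [(hc.continuousAt (x := (j₀.toAmbient, v))).eventually
        (isOpen_ne.mem_nhds hxv)] with z hz hz0 using absurd hz0 hz
  have hpev : ∀ᶠ a : E3 × E3 × (E3 →L[ℝ] E3) in 𝓝 j₀.toAmbient, ‖a.2.1‖ < Real.pi := by
    have hc : Continuous (fun a : E3 × E3 × (E3 →L[ℝ] E3) => ‖a.2.1‖) := by fun_prop
    exact hc.continuousAt.eventually (gt_mem_nhds hp)
  filter_upwards [(continuous_toAmbient.tendsto j₀).eventually key,
    (continuous_toAmbient.tendsto j₀).eventually hpev] with j hj hjp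
  refine ⟨hjp, fun v hv => ?_⟩
  rw [← hval]
  exact hj v (by simpa using hv) (inner_sphere_tangent j.x v)

theorem Jet.IsStrictlyElliptic.isPositive {j : Jet} (h : j.IsStrictlyElliptic) :
    (j.M + coeffA j.x j.p).IsPositive := by
  refine isPositive_of_unit (j.symm.add (coeffA_isSymmetric h.1)) fun v hv => ?_
  rw [add_apply, inner_add_left, inner_coeffA h.1 hv]
  exact (h.2 v hv).le

theorem Jet.IsStrictlyElliptic.exists_ellipticF {j : Jet} (h : j.IsStrictlyElliptic) :
    ∃ (φ : S2 → ℝ) (hφ : ContMDiff (𝓡 2) 𝓘(ℝ, ℝ) ∞ φ), φ ∈ ellipticF ∧ jetOf φ hφ j.x = j := by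
  obtain ⟨φ, hφ, hm, hg, hh⟩ := exists_ellipticF_jet h.1 j.symm h.2
  refine ⟨φ, hφ, hm, ?_⟩
  cases j
  simp only [jetOf, Jet.mk.injEq, heq_eq_eq, true_and]
  exact ⟨hg, hh⟩

/-! ### Semicontinuous envelopes -/

/-- Lower semicontinuity of the envelope, which permits verification at perturbed jets followed by
passage to the limit. -/
theorem lowerEnv_le_of_tendsto {F : Jet → ℝ} {j : Jet} {ι : Type*} {l : Filter ι} [l.NeBot]
    {J : ι → Jet} (hJ : Filter.Tendsto J l (𝓝 j)) (h : ∀ᶠ i in l, lowerEnv F (J i) ≤ 0) :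
    lowerEnv F j ≤ 0 := by
  by_contra hlt
  push Not at hlt
  obtain ⟨c, hc0, hc⟩ := exists_between hlt
  have h1 := Filter.eventually_lt_of_lt_liminf hc
  obtain ⟨i, hi, hi'⟩ := ((hJ.eventually h1.eventually_nhds).and h).exists
  have h2 : c ≤ lowerEnv F (J i) :=
    Filter.le_liminf_of_le (by isBoundedDefault) (hi.mono fun _ h => h.le)
  exact absurd (h2.trans hi') (not_le.2 hc0)

theorem le_upperEnv_of_tendsto {F : Jet → ℝ} {j : Jet} {ι : Type*} {l : Filter ι} [l.NeBot]
    {J : ι → Jet} (hJ : Filter.Tendsto J l (𝓝 j)) (h : ∀ᶠ i in l, 0 ≤ upperEnv F (J i)) :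
    0 ≤ upperEnv F j := by
  by_contra hlt
  push Not at hlt
  obtain ⟨c, hc, hc0⟩ := exists_between hlt
  have h1 := Filter.eventually_lt_of_limsup_lt hc
  obtain ⟨i, hi, hi'⟩ := ((hJ.eventually h1.eventually_nhds).and h).exists
  have h2 : upperEnv F (J i) ≤ c :=
    Filter.limsup_le_of_le (by isBoundedDefault) (hi.mono fun _ h => h.le)
  exact absurd (hi'.trans h2) (not_le.2 hc0)

theorem coe_le_upperEnv (F : Jet → ℝ) (j : Jet) : (F j : EReal) ≤ upperEnv F j := by
  refine Filter.le_limsup_of_frequently_le ?_ (by isBoundedDefault)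
  intro h
  exact h.self_of_nhds le_rfl

/-! ### Comparison of F and G on jets. -/

section Operators

variable {f₁ f₂ : S2 → ℝ} {detPlus : (x : S2) → (TangentPlane x →L[ℝ] TangentPlane x) → ℝ} {R : ℝ}

theorem opFPlus_eq_opF (hdet : IsModifiedDet detPlus) {j : Jet} (h : j.IsStrictlyElliptic) :
    opFPlus detPlus f₁ f₂ j = opF f₁ f₂ j := by
  rw [opFPlus, opF, (hdet j.x _).1 h.isPositive]

theorem coeffH_nonneg (hdata : NonsmoothData f₁ f₂) (x : S2) (p : TangentPlane x) :
    0 ≤ coeffH f₁ f₂ x p := by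
  obtain ⟨m, hm, hm'⟩ := hdata.lower_bound
  exact div_nonneg (mul_nonneg (Real.sqrt_nonneg _) (hdata.nonneg x)) (hm.le.trans (hm' _))

theorem opG_nonneg (hdata : NonsmoothData f₁ f₂) (hdet : IsModifiedDet detPlus) {j : Jet}
    (hp : ‖j.p‖ < Real.pi) {v : TangentPlane j.x} (hv : ‖v‖ = 1)
    (h : inner ℝ (j.M v) v + costForm j.p v < 0) : 0 ≤ opG detPlus f₁ f₂ R j := by
  have hnot : ¬ (j.M + coeffA j.x j.p).IsPositive := by
    intro hpos
    have h1 : 0 ≤ inner ℝ ((j.M + coeffA j.x j.p) v) v := hpos.2 v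
    rw [add_apply, inner_add_left, inner_coeffA hp hv] at h1
    linarith
  have h1 := (hdet j.x _).2 hnot
  have h2 := coeffH_nonneg hdata j.x j.p
  refine le_max_of_le_left ?_
  rw [opFPlus]
  linarith

/-- Away from ellipticity the supersolution inequality is automatic: det⁺ is negative and H is
nonnegative, so G ≥ 0 already at the jet itself. -/
theorem upperEnv_opG_nonneg (hdata : NonsmoothData f₁ f₂) (hdet : IsModifiedDet detPlus) {j : Jet}
    (hp : ‖j.p‖ < Real.pi) {v : TangentPlane j.x} (hv : ‖v‖ = 1)
    (h : inner ℝ (j.M v) v + costForm j.p v < 0) : 0 ≤ upperEnv (opG detPlus f₁ f₂ R) j :=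
  (EReal.coe_nonneg.2 (opG_nonneg hdata hdet hp hv h)).trans (coe_le_upperEnv _ j)

theorem lowerEnv_opG_le (hdet : IsModifiedDet detPlus) (hR : Real.pi < R) {j : Jet}
    (hj : j.IsStrictlyElliptic) (h : lowerEnv (opF f₁ f₂) j ≤ 0) :
    lowerEnv (opG detPlus f₁ f₂ R) j ≤ 0 := by
  by_contra hlt
  push Not at hlt
  obtain ⟨c, hc0, hc⟩ := exists_between hlt
  have h1 := Filter.eventually_lt_of_lt_liminf hc
  have h2 : c ≤ lowerEnv (opF f₁ f₂) j := by
    refine Filter.le_liminf_of_le (by isBoundedDefault) ?_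
    filter_upwards [h1, hj.eventually] with i hi hij
    rw [opG, opFPlus_eq_opF hdet hij] at hi
    -- Since |p| < π < R, a positive value of G can only come from F.
    have hneg : ‖i.p‖ - R < 0 := by linarith [hij.1]
    have hpos : 0 < max (opF f₁ f₂ i) (‖i.p‖ - R) := EReal.coe_pos.1 (hc0.trans hi)
    rcases lt_max_iff.1 hpos with h' | h'
    · rw [max_eq_left (hneg.le.trans h'.le)] at hi
      exact hi.le
    · exact absurd h' (not_lt.2 hneg.le)
  exact absurd (h2.trans h) (not_le.2 hc0)

theorem le_upperEnv_opG (hdet : IsModifiedDet detPlus) {j : Jet} (hj : j.IsStrictlyElliptic)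
    (h : 0 ≤ upperEnv (opF f₁ f₂) j) : 0 ≤ upperEnv (opG detPlus f₁ f₂ R) j := by
  refine h.trans (Filter.limsup_le_limsup ?_)
  filter_upwards [hj.eventually] with i hi
  rw [opG, opFPlus_eq_opF hdet hi]
  exact EReal.coe_le_coe_iff.2 (le_max_left _ _)

/-! ### Transfer of the sub- and supersolution properties from F to G. -/

theorem grad_hess_of_jetOf_eq_shift {φ ψ : S2 → ℝ} (hφ : ContMDiff (𝓡 2) 𝓘(ℝ, ℝ) ∞ φ)
    (hψ : ContMDiff (𝓡 2) 𝓘(ℝ, ℝ) ∞ ψ) {x : S2} {δ : ℝ}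
    (h : jetOf ψ hψ x = (jetOf φ hφ x).shift δ) :
    grad ψ x = grad φ x ∧ hess ψ x = hess φ x + δ • ContinuousLinearMap.id ℝ (TangentPlane x) := by
  obtain ⟨-, h1, h2⟩ := Jet.mk.inj h
  exact ⟨eq_of_heq h1, eq_of_heq h2⟩

theorem IsViscositySubsolution.opG {u : S2 → ℝ} (hdet : IsModifiedDet detPlus)
    (hR : Real.pi < R) (hconv : IsCConvex u)
    (hu : IsViscositySubsolution (opF f₁ f₂) ellipticF u) :
    IsViscositySubsolution (opG detPlus f₁ f₂ R) ellipticG u := by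
  refine ⟨hu.1, fun x φ hφ _ hmax => ?_⟩
  obtain ⟨hp, hell⟩ := hconv.elliptic_of_isLocalMax hφ hmax
  -- Adding δ to the Hessian turns the weak ellipticity coming from c-convexity into strict
  -- ellipticity and makes ψ - φ locally minimal, so that u - ψ still has a local maximum.
  refine lowerEnv_le_of_tendsto (l := 𝓝[>] (0 : ℝ))
    ((jetOf φ hφ x).tendsto_shift.mono_left nhdsWithin_le_nhds) ?_
  filter_upwards [self_mem_nhdsWithin] with δ hδ
  have hδ : 0 < δ := hδ
  have hse : ((jetOf φ hφ x).shift δ).IsStrictlyElliptic := by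
    refine ⟨hp, fun v hv => ?_⟩
    have h1 := (jetOf φ hφ x).inner_shift δ (v := v) hv
    have h2 := hell v hv
    rw [h1]
    change 0 < inner ℝ (hess φ x v) v + δ + costForm (grad φ x) v
    linarith
  obtain ⟨ψ, hψ, hmem, hjet⟩ := hse.exists_ellipticF
  obtain ⟨hg, hh⟩ := grad_hess_of_jetOf_eq_shift hφ hψ hjet
  refine lowerEnv_opG_le hdet hR hse ?_
  rw [← hjet]
  refine hu.2 x ψ hψ hmem ?_
  have := hmax.sub (isLocalMin_sub_of_jets hψ hφ hg hδ hh)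
  simpa using this

/-- The expression is c + r cot r. Multiplied by the positive factor sinc r it becomes cos r + c
sinc r, which tends to -1 as r tends to π. -/
theorem eventually_not_elliptic (c : ℝ) :
    ∀ᶠ r in 𝓝[<] Real.pi, c - deriv costProfile (Real.cos r) * Real.cos r < 0 := by
  have hc : Continuous (fun r : ℝ => Real.cos r + c * Real.sinc r) := by
    have := Real.continuous_sinc
    fun_prop
  have hπ : Real.cos Real.pi + c * Real.sinc Real.pi < 0 := by
    rw [Real.sinc_of_ne_zero Real.pi_ne_zero]; simp
  filter_upwards [(hc.continuousAt.eventually (gt_mem_nhds hπ)).filter_mono nhdsWithin_le_nhds,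
    Ioo_mem_nhdsLT Real.pi_pos] with r hr hr'
  have h1 := deriv_costProfile_cos hr'.1.le hr'.2
  have h2 := sinc_pos hr'.1.le hr'.2
  have h3 : (c - deriv costProfile (Real.cos r) * Real.cos r) * Real.sinc r =
      Real.cos r + c * Real.sinc r := by linear_combination (-Real.cos r) * h1
  by_contra hnn
  have := mul_nonneg (not_lt.1 hnn) h2.le
  rw [h3] at this
  exact absurd hr (not_lt.2 this)

theorem IsViscositySupersolution.opG {u : S2 → ℝ} (hdata : NonsmoothData f₁ f₂)
    (hdet : IsModifiedDet detPlus) (hconv : IsCConvex u)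
    (hu : IsViscositySupersolution (opF f₁ f₂) ellipticF u) :
    IsViscositySupersolution (opG detPlus f₁ f₂ R) ellipticG u := by
  refine ⟨hu.1, fun x φ hφ _ hmin => ?_⟩
  rcases (hconv.norm_grad_le hφ hmin).lt_or_eq with hp | hp
  · have hshift := (jetOf φ hφ x).tendsto_shift.comp
      (show Filter.Tendsto (fun δ : ℝ => -δ) (𝓝[>] 0) (𝓝 0) by
        simpa using (continuous_neg.tendsto (0 : ℝ)).mono_left nhdsWithin_le_nhds)
    refine le_upperEnv_of_tendsto hshift ?_
    by_cases hj : (jetOf φ hφ x).IsStrictlyElliptic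
    · filter_upwards [self_mem_nhdsWithin, hshift.eventually hj.eventually] with δ hδ hse
      obtain ⟨ψ, hψ, hmem, hjet⟩ := hse.exists_ellipticF
      have hjet' : jetOf ψ hψ x = (jetOf φ hφ x).shift (-δ) := hjet
      obtain ⟨hg, hh⟩ := grad_hess_of_jetOf_eq_shift hφ hψ hjet'
      refine le_upperEnv_opG hdet hse ?_
      rw [← hjet]
      refine hu.2 x ψ hψ hmem ?_
      have := hmin.add (isLocalMin_sub_of_jets hφ hψ hg.symm hδ (by rw [hh]; module))
      simpa using this
    -- A failure of strict ellipticity gives a direction with nonpositive form, which the shift by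
    -- -δ makes strictly negative.
    · have hex : ∃ v : TangentPlane x, ‖v‖ = 1 ∧
          inner ℝ (hess φ x v) v + costForm (grad φ x) v ≤ 0 := by
        by_contra hne
        push Not at hne
        exact hj ⟨hp, hne⟩
      obtain ⟨v, hv, hle⟩ := hex
      filter_upwards [self_mem_nhdsWithin] with δ hδ
      have hδ : 0 < δ := hδ
      refine upperEnv_opG_nonneg hdata hdet (j := (jetOf φ hφ x).shift (-δ)) hp (v := v) hv ?_
      have h1 := (jetOf φ hφ x).inner_shift (-δ) (v := v) hv
      rw [h1]
      change inner ℝ (hess φ x v) v + -δ + costForm (grad φ x) v < 0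
      linarith
  -- When |∇φ| = π the value of A at ∇φ is only a convention, so the jet is approached by the
  -- gradients (r/π)∇φ with r < π. A direction orthogonal to ∇φ sees only the eigenvalue r cot r of
  -- A.
  · obtain ⟨v, hv, hpv⟩ := exists_unit_orthogonal (grad φ x)
    have hpath : Filter.Tendsto (fun r : ℝ => Jet.mk x ((r / Real.pi) • grad φ x) (hess φ x)
        (hess_isSymmetric hφ x)) (𝓝[<] Real.pi) (𝓝 (jetOf φ hφ x)) := by
      refine tendsto_jet (hM₀ := hess_isSymmetric hφ x) ?_ tendsto_const_nhds
      have hc : Continuous (fun r : ℝ => (r / Real.pi) • grad φ x) := by fun_prop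
      have := hc.tendsto Real.pi
      rw [div_self Real.pi_ne_zero, one_smul] at this
      exact this.mono_left nhdsWithin_le_nhds
    refine le_upperEnv_of_tendsto hpath ?_
    filter_upwards [eventually_not_elliptic (inner ℝ (hess φ x v) v),
      Ioo_mem_nhdsLT Real.pi_pos] with r hr hr'
    have hn : ‖(r / Real.pi) • grad φ x‖ = r := by
      rw [norm_smul, hp, Real.norm_of_nonneg (div_nonneg hr'.1.le Real.pi_pos.le),
        div_mul_cancel₀ _ Real.pi_ne_zero]
    refine upperEnv_opG_nonneg hdata hdet (v := v) (by rw [hn]; exact hr'.2) hv ?_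
    dsimp only
    rw [costForm, ← Submodule.coe_inner, Submodule.norm_coe, hn, real_inner_smul_left, hpv]
    simpa [sub_eq_add_neg] using hr

end Operators

end SphereOT

end

theorem mainTheorem4 (f₁ f₂ : SphereOT.S2 → ℝ) (hdata : SphereOT.NonsmoothData f₁ f₂)
    (detPlus : (x : SphereOT.S2) →
      (SphereOT.TangentPlane x →L[ℝ] SphereOT.TangentPlane x) → ℝ)
    (hdet : SphereOT.IsModifiedDet detPlus)
    (R : ℝ) (hR : Real.pi < R)
    (u : SphereOT.S2 → ℝ) (hLip : ∃ K : NNReal, LipschitzWith K u)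
    (hconv : SphereOT.IsCConvex u)
    (hu : SphereOT.IsViscositySolution (SphereOT.opF f₁ f₂) SphereOT.ellipticF u) :
    SphereOT.IsViscositySolution (SphereOT.opG detPlus f₁ f₂ R) SphereOT.ellipticG u :=
  ⟨hu.1, hu.2.1.opG hdet hR hconv, hu.2.2.opG hdata hdet hconv⟩
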